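/- Let $G=(V,E)$ be a finite connected simple graph embedded in the plane (vertices are distinct points, edges are simple arcs meeting only at common end-vertices). Consider the Ashkin--Teller model on $G$ with free boundary conditions, coupling constants $J=(J_e)_{e\in E}$ and $U=0$, i.e. the probability measure on pairs $(\sigma,\tilde\sigma)\in\{-1,1\}^V\times\{-1,1\}^V$ with $$\mathbf P(\sigma,\tilde\sigma)=\frac1{\mathcal Z}\prod_{uv\in E}\exp\big(J_{uv}(\sigma_u\sigma_v+\tilde\sigma_u\tilde\sigma_v)\big)$$ (two independent copies of the Ising model), and write $\langle\cdot\rangle$ for its expectation. Assume that $J_e\ge 0$ for all $e\in E$ (the $J_e$ may otherwise be arbitrary). Let $s_1,\dots,s_n,t_1,\dots,t_n$ be vertices on the outer face of $G$ (repetitions are allowed) such that $s_1,s_2,\dots,s_n,t_n,t_{n-1},\dots,t_1$ is a counterclockwise order around the outer face, that is: they can be joined, by simple arcs which run in the outer face and do not meet except at a common starting vertex, to points in counterclockwise order (within one turn) on a circle that surrounds the drawing. Let $M$ be the $n\times n$ matrix with entries $M_{ij}=\langle\sigma_{s_i}\sigma_{t_j}\rangle$, and for $I,I'\subseteq\{1,\dots,n\}$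 let $M^{I,I'}$ be its restriction to the rows in $I$ and the columns in $I'$. Then: 1. $M$ is totally nonnegative, i.e. $\det M^{I,I'}\ge 0$ for all $I,I'\subseteq\{1,\dots,n\}$ with $|I|=|I'|$. 2. For all $I,I'\subseteq\{1,\dots,n\}$ with $|I|=|I'|=k$, one has $\det M^{I,I'}>0$ if and only if there exist $k$ pairwise vertex-disjoint paths, using only edges $e$ with $J_e>0$, that connect in pairs the $s_i$, $i\in I$, with the $t_j$, $j\in I'$ (a path may consist of a single vertex). 3. In particular, if $J_e>0$ for all $e\in E$, then for all such $I,I'$, $\det M^{I,I'}>0$ if and only if there exist $k$ pairwise vertex-disjoint paths in $G$ that connect in pairs the $s_i$, $i\in I$, with the $t_j$, $j\in I'$. -/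

import Mathlib

noncomputable section

namespace BoundaryIsing

/-! ### The Ashkin–Teller model on a finite graph -/

section Model

variable {V : Type*} [Fintype V] [DecidableEq V]

/-- Spin configurations: functions from the vertices to `{-1, 1}`. -/
abbrev Spins (V : Type*) := V → ℤˣ

/-- The real value `σ_v` of the spin at `v`. -/
def spin (σ : Spins V) (v : V) : ℝ := ((σ v : ℤ) : ℝ)

/-- `σ_u σ_v` for an edge `e = uv`. -/
def edgeSpin (σ : Spins V) (e : Sym2 V) : ℝ := (e.map (spin σ)).mul

/-- The unnormalised weight
`∏_{uv ∈ E} exp (J_uv (σ_u σ_v + σ'_u σ'_v) + U_uv (σ_u σ_v σ'_u σ'_v + 1))`.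
Only the values of `J` and `U` on edges of `G` matter. -/
def weight (G : SimpleGraph V) [DecidableRel G.Adj] (J U : Sym2 V → ℝ) (σ σ' : Spins V) : ℝ :=
  ∏ e ∈ G.edgeFinset,
    Real.exp (J e * (edgeSpin σ e + edgeSpin σ' e) + U e * (edgeSpin σ e * edgeSpin σ' e + 1))

/-- The partition function of the Ashkin–Teller model (free boundary conditions). -/
def partitionFunction (G : SimpleGraph V) [DecidableRel G.Adj] (J U : Sym2 V → ℝ) : ℝ :=
  ∑ σ : Spins V, ∑ σ' : Spins V, weight G J U σ σ'

/-- The probability of the pair `(σ, σ')`. -/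
def prob (G : SimpleGraph V) [DecidableRel G.Adj] (J U : Sym2 V → ℝ) (σ σ' : Spins V) : ℝ :=
  weight G J U σ σ' / partitionFunction G J U

/-- The expectation `⟨F(σ, σ')⟩`. -/
def expectation (G : SimpleGraph V) [DecidableRel G.Adj] (J U : Sym2 V → ℝ)
    (F : Spins V → Spins V → ℝ) : ℝ :=
  ∑ σ : Spins V, ∑ σ' : Spins V, F σ σ' * prob G J U σ σ'

/-- The matrix `M i j = ⟨σ_{s i} σ_{t j}⟩` of two-point functions. -/
def twoPointMatrix (G : SimpleGraph V) [DecidableRel G.Adj] (J U : Sym2 V → ℝ) {n : ℕ}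
    (s t : Fin n → V) : Matrix (Fin n) (Fin n) ℝ :=
  fun i j => expectation G J U (fun σ _ => spin σ (s i) * spin σ (t j))

end Model

/-! ### Minors -/

/-- The minor `det M^{I,I'}`: rows in `I` and columns in `I'`, both in increasing order. -/
def minor {n k : ℕ} (M : Matrix (Fin n) (Fin n) ℝ) (I I' : Finset (Fin n))
    (hI : I.card = k) (hI' : I'.card = k) : ℝ :=
  (M.submatrix (I.orderEmbOfFin hI) (I'.orderEmbOfFin hI')).det

/-- All minors, of all sizes, are nonnegative. -/
def TotallyNonnegative {n : ℕ} (M : Matrix (Fin n) (Fin n) ℝ) : Prop :=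
  ∀ (k : ℕ) (I I' : Finset (Fin n)) (hI : I.card = k) (hI' : I'.card = k),
    0 ≤ minor M I I' hI hI'

/-! ### Vertex-disjoint paths -/

/-- There are paths in `H`, no two of which share a vertex, that join the `s i`, `i ∈ I`, with the
`t j`, `j ∈ I'`, in pairs (in some bijective manner `e`). A path may consist of a single vertex. -/
def HasDisjointPaths {V : Type*} (H : SimpleGraph V) {n : ℕ} (s t : Fin n → V)
    (I I' : Finset (Fin n)) : Prop :=
  ∃ (e : I ≃ I') (p : ∀ i : I, H.Path (s i) (t (e i))),
    ∀ i j : I, i ≠ j → List.Disjoint (p i).1.support (p j).1.support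

/-- The subgraph of `G` formed by the edges with a positive coupling constant. -/
def positiveSubgraph {V : Type*} (G : SimpleGraph V) (J : Sym2 V → ℝ) : SimpleGraph V :=
  SimpleGraph.fromEdgeSet {e | e ∈ G.edgeSet ∧ 0 < J e}

/-! ### Plane graphs and the order of nodes around the outer face -/

/-- An embedding of `G` in the plane `ℂ`: vertices are distinct points, edges are simple arcs
between their endpoints which meet vertices and each other only in common endpoints. -/
structure PlaneEmbedding {V : Type*} (G : SimpleGraph V) where
  pt : V → ℂ
  pt_injective : Function.Injective pt
  arc : G.edgeSet → C(unitInterval, ℂ)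
  arc_injective : ∀ e, Function.Injective (arc e)
  arc_ends : ∀ e, s(arc e 0, arc e 1) = (e : Sym2 V).map pt
  mem_of_arc_eq_pt : ∀ (e : G.edgeSet) (x : unitInterval) (v : V), arc e x = pt v → v ∈ (e : Sym2 V)
  arc_inter : ∀ e f : G.edgeSet, e ≠ f → ∀ x y : unitInterval, arc e x = arc f y → ∃ v, arc e x = pt v

namespace PlaneEmbedding

variable {V : Type*} {G : SimpleGraph V}

/-- The set of points of the plane covered by the drawing. -/
def drawing (D : PlaneEmbedding G) : Set ℂ := Set.range D.pt ∪ ⋃ e, Set.range (D.arc e)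

/-- The outer face: the unbounded component of the complement of the drawing. -/
def outerFace (D : PlaneEmbedding G) : Set ℂ :=
  {z | z ∈ D.drawingᶜ ∧ ¬ Bornology.IsBounded (connectedComponentIn D.drawingᶜ z)}

/-- The nodes `p 0, p 1, …, p (m-1)` (vertices, possibly repeated) lie on the outer face and are
listed in counterclockwise order around it: they can be joined, by simple arcs which run in the
outer face and do not meet each other except at a common starting vertex, to points of a large
circle around the drawing which are in counterclockwise order (within one turn). -/
def IsOuterOrder (D : PlaneEmbedding G) {m : ℕ} (p : Fin m → V) : Prop :=
  ∃ (R : ℝ) (θ : Fin m → ℝ) (γ : Fin m → C(unitInterval, ℂ)),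
    D.drawing ⊆ Metric.ball 0 R ∧
    StrictMono θ ∧ (∀ i j, θ j < θ i + 2 * Real.pi) ∧
    (∀ i, Function.Injective (γ i)) ∧
    (∀ i, γ i 0 = D.pt (p i)) ∧
    (∀ i, γ i 1 = R * Complex.exp (θ i * Complex.I)) ∧
    (∀ i (x : unitInterval), x ≠ 1 → γ i x ∈ Metric.ball 0 R) ∧
    (∀ i (x : unitInterval), x ≠ 0 → γ i x ∈ D.outerFace) ∧
    (∀ i j, i ≠ j → ∀ x y : unitInterval, γ i x = γ j y → x = 0 ∧ y = 0)

end PlaneEmbedding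

/-- The sequence `s_1, …, s_n, t_n, …, t_1`. -/
def parallelSeq {V : Type*} {n : ℕ} (s t : Fin n → V) : Fin (n + n) → V :=
  Fin.append s (fun i => t i.rev)

end BoundaryIsing

end

noncomputable section

namespace BoundaryIsing

/-! ### Curves in a disk with interlaced endpoints meet -/

/-- A real function on the line whose cosine stays positive stays within one branch. -/
theorem exists_int_abs_sub_lt_of_cos_pos {u : ℝ → ℝ} (hu : Continuous u)
    (hcos : ∀ x ∈ Set.Icc (0 : ℝ) 1, 0 < Real.cos (u x)) :
    ∃ m : ℤ, ∀ x ∈ Set.Icc (0 : ℝ) 1, |u x - 2 * Real.pi * m| < Real.pi / 2 := by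
  have hpi := Real.pi_pos
  refine ⟨toIocDiv Real.two_pi_pos (-Real.pi) (u 0), ?_⟩
  set m := toIocDiv Real.two_pi_pos (-Real.pi) (u 0)
  set v : ℝ → ℝ := fun x => u x - 2 * Real.pi * m with hv
  have hvc : Continuous v := hu.sub continuous_const
  have hvcos : ∀ x ∈ Set.Icc (0 : ℝ) 1, 0 < Real.cos (v x) := by
    intro x hx
    have h := hcos x hx
    rw [← Real.cos_sub_int_mul_two_pi (u x) m] at h
    simpa [hv, mul_comm] using h
  have h0 : v 0 ∈ Set.Ioc (-Real.pi) Real.pi := by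
    have h := sub_toIocDiv_zsmul_mem_Ioc Real.two_pi_pos (-Real.pi) (u 0)
    simp only [zsmul_eq_mul] at h
    rw [Set.mem_Ioc] at h ⊢
    simp only [hv]
    constructor <;> linarith [h.1, h.2, mul_comm (m : ℝ) (2 * Real.pi)]
  have hne : ∀ x ∈ Set.Icc (0 : ℝ) 1, v x ≠ Real.pi / 2 ∧ v x ≠ -(Real.pi / 2) := by
    intro x hx
    constructor <;> intro h <;> have := hvcos x hx <;> simp [h] at this
  have h0' : |v 0| < Real.pi / 2 := by
    by_contra hcon
    have h1 := Real.cos_nonpos_of_pi_div_two_le_of_le (not_lt.mp hcon)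
      (by have := abs_le.mpr ⟨h0.1.le, h0.2⟩; linarith)
    rw [Real.cos_abs] at h1
    linarith [hvcos 0 (by simp)]
  intro x hx
  change |v x| < _
  rw [abs_lt] at h0' ⊢
  have hsub : Set.Icc 0 x ⊆ Set.Icc (0 : ℝ) 1 := Set.Icc_subset_Icc_right hx.2
  constructor
  · by_contra hcon
    obtain ⟨y, hy, hy'⟩ := intermediate_value_Icc' hx.1 hvc.continuousOn
      (show -(Real.pi / 2) ∈ Set.Icc (v x) (v 0) from ⟨not_lt.mp hcon, h0'.1.le⟩)
    exact (hne y (hsub hy)).2 hy'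
  · by_contra hcon
    obtain ⟨y, hy, hy'⟩ := intermediate_value_Icc hx.1 hvc.continuousOn
      (show Real.pi / 2 ∈ Set.Icc (v 0) (v x) from ⟨h0'.2.le, not_lt.mp hcon⟩)
    exact (hne y (hsub hy)).1 hy'

/-- The closed disk of radius `R` lies strictly on one side of the tangent at each of its boundary
points, that point excepted. -/
theorem re_mul_circle_sub_pos {R φ : ℝ} (hR : 0 < R) {z : ℂ} (hz : ‖z‖ ≤ R)
    (hne : (R : ℂ) * Complex.exp (φ * Complex.I) ≠ z) :
    0 < (Complex.exp (-(φ * Complex.I)) * ((R : ℂ) * Complex.exp (φ * Complex.I) - z)).re := by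
  have h1 : Complex.exp (-(φ * Complex.I)) * Complex.exp (φ * Complex.I) = 1 := by
    rw [← Complex.exp_add]; simp
  set w := Complex.exp (-(φ * Complex.I)) * z with hw
  have hwn : ‖w‖ ≤ R := by
    have : ‖Complex.exp (-(φ * Complex.I))‖ = 1 := by
      have := Complex.norm_exp_ofReal_mul_I (-φ)
      rwa [Complex.ofReal_neg, neg_mul] at this
    rw [hw, norm_mul, this, one_mul]; exact hz
  have e : Complex.exp (-(φ * Complex.I)) * ((R : ℂ) * Complex.exp (φ * Complex.I) - z)
      = R - w := by
    rw [hw, mul_sub, ← mul_assoc, mul_comm _ (R : ℂ), mul_assoc, h1, mul_one]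
  rw [e, Complex.sub_re, Complex.ofReal_re, sub_pos]
  refine lt_of_le_of_ne ((Complex.re_le_norm w).trans hwn) fun h => hne ?_
  have hwR : w = R := by
    have him : w.im = 0 := by
      have h2 := Complex.sq_norm w
      rw [Complex.normSq_apply] at h2
      have h3 : ‖w‖ ^ 2 ≤ R ^ 2 := by gcongr
      have : w.im * w.im ≤ 0 := by nlinarith
      exact mul_self_eq_zero.mp (le_antisymm this (mul_self_nonneg _))
    exact Complex.ext (by simpa using h) (by simpa using him)
  rw [← hwR, hw, mul_comm, ← mul_assoc, mul_comm (Complex.exp (φ * Complex.I)), h1, one_mul]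

theorem cos_im_sub_pos {φ : ℝ} {l w : ℂ} (hl : Complex.exp l = w)
    (hw : 0 < (Complex.exp (-(φ * Complex.I)) * w).re) : 0 < Real.cos (l.im - φ) := by
  rw [← hl, ← Complex.exp_add, Complex.exp_re] at hw
  have := pos_of_mul_pos_right hw (Real.exp_pos _).le
  simpa [neg_add_eq_sub] using this

/-- Two curves in a closed disk, whose endpoints are interlaced on the boundary circle, meet. -/
theorem exists_eq_of_interlaced {R : ℝ} (hR : 0 < R) {θ₁ θ₂ θ₃ θ₄ : ℝ} (h12 : θ₁ < θ₂)
    (h23 : θ₂ < θ₃) (h34 : θ₃ < θ₄) (h41 : θ₄ < θ₁ + 2 * Real.pi) {f g : ℝ → ℂ}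
    (hf : Continuous f) (hg : Continuous g) (hfR : ∀ x, ‖f x‖ ≤ R) (hgR : ∀ x, ‖g x‖ ≤ R)
    (hf0 : f 0 = R * Complex.exp (θ₁ * Complex.I)) (hf1 : f 1 = R * Complex.exp (θ₃ * Complex.I))
    (hg0 : g 0 = R * Complex.exp (θ₂ * Complex.I)) (hg1 : g 1 = R * Complex.exp (θ₄ * Complex.I)) :
    ∃ x y, f x = g y := by
  by_contra! hne
  have hpi := Real.pi_pos
  obtain ⟨l, hlc, hl⟩ := Complex.exists_continuousOn_eqOn_exp_comp (X := ℝ × ℝ) (U := Set.univ)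
    (g := fun q => f q.1 - g q.2)
    (have := convex_univ.contractibleSpace (Set.univ_nonempty (α := ℝ × ℝ)); .ofContractible _) isOpen_univ
    (by fun_prop) (by rintro ⟨q, -, hq⟩; exact hne _ _ (sub_eq_zero.mp hq))
  rw [continuousOn_univ] at hlc
  replace hl : ∀ x y, Complex.exp (l (x, y)) = f x - g y := fun x y => hl (Set.mem_univ (x, y))
  have hneg : ∀ (φ : ℝ) (w : ℂ), Complex.exp (-((φ + Real.pi : ℝ) * Complex.I)) * w
      = Complex.exp (-(φ * Complex.I)) * (-w) := by
    intro φ w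
    have : -((φ + Real.pi : ℝ) * Complex.I) = -(φ * Complex.I) - Real.pi * Complex.I := by
      push_cast; ring
    rw [this, Complex.exp_sub, Complex.exp_pi_mul_I]; ring
  obtain ⟨m₁, h₁⟩ := exists_int_abs_sub_lt_of_cos_pos (u := fun y => (l (0, y)).im - θ₁)
    (by fun_prop) fun y _ => cos_im_sub_pos (hl 0 y) (by
      rw [hf0]; exact re_mul_circle_sub_pos hR (hgR y) (hf0 ▸ hne 0 y))
  obtain ⟨m₃, h₃⟩ := exists_int_abs_sub_lt_of_cos_pos (u := fun y => (l (1, y)).im - θ₃)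
    (by fun_prop) fun y _ => cos_im_sub_pos (hl 1 y) (by
      rw [hf1]; exact re_mul_circle_sub_pos hR (hgR y) (hf1 ▸ hne 1 y))
  obtain ⟨m₂, h₂⟩ := exists_int_abs_sub_lt_of_cos_pos
    (u := fun x => (l (x, 0)).im - (θ₂ + Real.pi : ℝ))
    (by fun_prop) fun x _ => cos_im_sub_pos (hl x 0) (by
      rw [hneg, neg_sub, hg0]; exact re_mul_circle_sub_pos hR (hfR x) (hg0 ▸ (hne x 0).symm))
  obtain ⟨m₄, h₄⟩ := exists_int_abs_sub_lt_of_cos_pos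
    (u := fun x => (l (x, 1)).im - (θ₄ + Real.pi : ℝ))
    (by fun_prop) fun x _ => cos_im_sub_pos (hl x 1) (by
      rw [hneg, neg_sub, hg1]; exact re_mul_circle_sub_pos hR (hfR x) (hg1 ▸ (hne x 1).symm))
  have i0 : (0 : ℝ) ∈ Set.Icc (0 : ℝ) 1 := by simp
  have i1 : (1 : ℝ) ∈ Set.Icc (0 : ℝ) 1 := by simp
  have a1 := abs_lt.mp (h₁ 0 i0)
  have a2 := abs_lt.mp (h₁ 1 i1)
  have a3 := abs_lt.mp (h₃ 0 i0)
  have a4 := abs_lt.mp (h₃ 1 i1)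
  have b1 := abs_lt.mp (h₂ 0 i0)
  have b2 := abs_lt.mp (h₂ 1 i1)
  have b3 := abs_lt.mp (h₄ 0 i0)
  have b4 := abs_lt.mp (h₄ 1 i1)
  have key : ∀ {k : ℤ} {r : ℤ}, 2 * Real.pi * (r : ℝ) < 2 * Real.pi * k → r + 1 ≤ k := by
    intro k r h
    have := lt_of_mul_lt_mul_left h (by positivity)
    exact_mod_cast this
  have c1 : (m₁ - m₂ - 2 : ℤ) + 1 ≤ 0 := key (by push_cast; linarith)
  have c2 : (0 : ℤ) + 1 ≤ m₁ - m₂ := key (by push_cast; linarith)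
  have c3 : (m₃ - m₂ - 1 : ℤ) + 1 ≤ 0 := key (by push_cast; linarith)
  have c4 : (-1 : ℤ) + 1 ≤ m₃ - m₂ := key (by push_cast; linarith)
  have c5 : (m₃ - m₄ - 2 : ℤ) + 1 ≤ 0 := key (by push_cast; linarith)
  have c6 : (0 : ℤ) + 1 ≤ m₃ - m₄ := key (by push_cast; linarith)
  have c7 : (m₁ - m₄ - 2 : ℤ) + 1 ≤ 0 := key (by push_cast; linarith)
  have c8 : (0 : ℤ) + 1 ≤ m₁ - m₄ := key (by push_cast; linarith)
  omega

/-- Two path-connected pieces of a closed disk that join interlaced points of the boundary circle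
meet. -/
theorem JoinedIn.nonempty_inter_of_interlaced {R : ℝ} (hR : 0 < R) {θ₁ θ₂ θ₃ θ₄ : ℝ}
    (h12 : θ₁ < θ₂) (h23 : θ₂ < θ₃) (h34 : θ₃ < θ₄) (h41 : θ₄ < θ₁ + 2 * Real.pi) {A B : Set ℂ}
    (hA : A ⊆ Metric.closedBall 0 R) (hB : B ⊆ Metric.closedBall 0 R)
    (hjA : JoinedIn A (R * Complex.exp (θ₁ * Complex.I)) (R * Complex.exp (θ₃ * Complex.I)))
    (hjB : JoinedIn B (R * Complex.exp (θ₂ * Complex.I)) (R * Complex.exp (θ₄ * Complex.I))) :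
    (A ∩ B).Nonempty := by
  obtain ⟨f, hf⟩ := hjA
  obtain ⟨g, hg⟩ := hjB
  have hf' : ∀ x, f.extend x ∈ A := fun x => hf _
  have hg' : ∀ x, g.extend x ∈ B := fun x => hg _
  obtain ⟨x, y, h⟩ := exists_eq_of_interlaced hR h12 h23 h34 h41 f.continuous_extend
    g.continuous_extend (fun x => by simpa using hA (hf' x)) (fun x => by simpa using hB (hg' x))
    f.extend_zero f.extend_one g.extend_zero g.extend_one
  exact ⟨f.extend x, hf' x, h ▸ hg' y⟩

/-! ### Clusters of edges in a plane drawing -/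

section Clusters

variable {V : Type*}

/-- Two vertices are linked by a set of edges if they lie in the same cluster of it. -/
def Linked (H : Finset (Sym2 V)) (u v : V) : Prop :=
  (SimpleGraph.fromEdgeSet (H : Set (Sym2 V))).Reachable u v

theorem Linked.refl (H : Finset (Sym2 V)) (u : V) : Linked H u u := SimpleGraph.Reachable.refl u

theorem Linked.symm {H : Finset (Sym2 V)} {u v : V} (h : Linked H u v) : Linked H v u :=
  SimpleGraph.Reachable.symm h

theorem Linked.trans {H : Finset (Sym2 V)} {u v w : V} (h : Linked H u v) (h' : Linked H v w) :
    Linked H u w := SimpleGraph.Reachable.trans h h'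

theorem Linked.of_mem {H : Finset (Sym2 V)} {e : Sym2 V} (he : e ∈ H) {u v : V} (hu : u ∈ e)
    (hv : v ∈ e) : Linked H u v := by
  by_cases huv : u = v
  · exact huv ▸ Linked.refl H u
  · refine SimpleGraph.Adj.reachable ?_
    rw [SimpleGraph.fromEdgeSet_adj]
    have : e = s(u, v) := (Sym2.mem_and_mem_iff huv).mp ⟨hu, hv⟩
    exact ⟨by simpa [← this] using he, huv⟩

/-- A property that spreads along the edges of `H` spreads to the whole cluster. -/
theorem Linked.induct {H : Finset (Sym2 V)} {Q : V → Prop}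
    (hQ : ∀ u v, s(u, v) ∈ H → Q u → Q v) {u v : V} (h : Linked H u v) (hu : Q u) : Q v := by
  obtain ⟨w⟩ := h
  induction w with
  | nil => exact hu
  | cons hadj _ ih =>
    rw [SimpleGraph.fromEdgeSet_adj] at hadj
    exact ih (hQ _ _ (by simpa using hadj.1) hu)

variable {G : SimpleGraph V}

namespace PlaneEmbedding

/-- The part of the drawing that belongs to the cluster of `u` in `H`. -/
def cluster (D : PlaneEmbedding G) (H : Finset (Sym2 V)) (u : V) : Set ℂ :=
  {z | ∃ v, Linked H u v ∧ z = D.pt v} ∪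
    {z | ∃ e : G.edgeSet, (e : Sym2 V) ∈ H ∧ (∀ v ∈ (e : Sym2 V), Linked H u v) ∧
      z ∈ Set.range (D.arc e)}

theorem cluster_subset_drawing (D : PlaneEmbedding G) (H : Finset (Sym2 V)) (u : V) :
    D.cluster H u ⊆ D.drawing := by
  rintro z (⟨v, -, rfl⟩ | ⟨e, -, -, hz⟩)
  · exact Or.inl ⟨v, rfl⟩
  · exact Or.inr (Set.mem_iUnion.mpr ⟨e, hz⟩)

theorem linked_of_pt_mem_cluster (D : PlaneEmbedding G) {H : Finset (Sym2 V)} {u v : V}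
    (h : D.pt v ∈ D.cluster H u) : Linked H u v := by
  rcases h with ⟨w, hw, he⟩ | ⟨e, -, he, x, hx⟩
  · exact D.pt_injective he ▸ hw
  · exact he v (D.mem_of_arc_eq_pt e x v hx)

theorem linked_of_mem_cluster (D : PlaneEmbedding G) {H : Finset (Sym2 V)} {u v : V} {z : ℂ}
    (hu : z ∈ D.cluster H u) (hv : z ∈ D.cluster H v) : Linked H u v := by
  by_cases hz : ∃ w, z = D.pt w
  · obtain ⟨w, rfl⟩ := hz
    exact (D.linked_of_pt_mem_cluster hu).trans (D.linked_of_pt_mem_cluster hv).symm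
  rcases hu with ⟨w, -, h⟩ | ⟨e, -, he, x, hx⟩
  · exact absurd ⟨w, h⟩ hz
  rcases hv with ⟨w, -, h⟩ | ⟨f, -, hf, y, hy⟩
  · exact absurd ⟨w, h⟩ hz
  by_cases hef : e = f
  · subst hef
    obtain ⟨w, hw⟩ : ∃ w, w ∈ (e : Sym2 V) := ⟨_, Sym2.out_fst_mem _⟩
    exact (he w hw).trans (hf w hw).symm
  · obtain ⟨w, hw⟩ := D.arc_inter e f hef x y (hx.trans hy.symm)
    exact absurd ⟨w, hx ▸ hw⟩ hz

theorem joinedIn_cluster (D : PlaneEmbedding G) {H : Finset (Sym2 V)}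
    (hH : ∀ e ∈ H, e ∈ G.edgeSet) {u v : V} (h : Linked H u v) :
    JoinedIn (D.cluster H u) (D.pt u) (D.pt v) := by
  suffices Linked H u v ∧ JoinedIn (D.cluster H u) (D.pt u) (D.pt v) from this.2
  refine Linked.induct (Q := fun v => Linked H u v ∧ JoinedIn (D.cluster H u) (D.pt u) (D.pt v))
    ?_ h ⟨Linked.refl H u, JoinedIn.refl (Or.inl ⟨u, Linked.refl H u, rfl⟩)⟩
  rintro a b hab ⟨hla, hja⟩
  have hlb : Linked H u b := hla.trans (Linked.of_mem hab (by simp) (by simp))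
  refine ⟨hlb, hja.trans ?_⟩
  set e : G.edgeSet := ⟨s(a, b), hH _ hab⟩
  have hsub : Set.range (D.arc e) ⊆ D.cluster H u := fun z hz => Or.inr ⟨e, hab, by
    intro v hv
    rcases Sym2.mem_iff.mp hv with rfl | rfl
    exacts [hla, hlb], hz⟩
  have hj : JoinedIn (Set.range (D.arc e)) (D.arc e 0) (D.arc e 1) :=
    ⟨⟨D.arc e, rfl, rfl⟩, fun x => ⟨x, rfl⟩⟩
  have hends := D.arc_ends e
  simp only [e, Sym2.map_mk, Sym2.eq_iff] at hends
  rcases hends with ⟨h0, h1⟩ | ⟨h0, h1⟩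
  · rw [← h0, ← h1]; exact hj.mono hsub
  · rw [← h0, ← h1]; exact hj.symm.mono hsub

/-- Clusters of edges of a plane graph do not cross: if four nodes around the outer face are linked
in an interlaced manner, then they all lie in one cluster. -/
theorem IsOuterOrder.linked_of_interlaced {D : PlaneEmbedding G} {m : ℕ} {p : Fin m → V}
    (hp : D.IsOuterOrder p) {H : Finset (Sym2 V)} (hH : ∀ e ∈ H, e ∈ G.edgeSet)
    {a b c d : Fin m} (hab : a < b) (hbc : b < c) (hcd : c < d) (hac : Linked H (p a) (p c))
    (hbd : Linked H (p b) (p d)) : Linked H (p a) (p b) := by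
  obtain ⟨R, θ, γ, hR, hθ, hθ', -, hγ0, hγ1, hγR, hγout, hγγ⟩ := hp
  have hRpos : 0 < R := by
    have := hR (Or.inl ⟨p a, rfl⟩)
    exact lt_of_le_of_lt (norm_nonneg (D.pt (p a))) (by simpa using this)
  have hrange : ∀ i, Set.range (γ i) ⊆ Metric.closedBall 0 R := by
    rintro i _ ⟨x, rfl⟩
    by_cases hx : x = 1
    · rw [hx, hγ1]; simp [Complex.norm_exp_ofReal_mul_I, abs_of_pos hRpos]
    · exact Metric.ball_subset_closedBall (hγR i x hx)
  have hcl : ∀ u, D.cluster H u ⊆ Metric.closedBall 0 R := fun u =>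
    (D.cluster_subset_drawing H u).trans (hR.trans Metric.ball_subset_closedBall)
  have hjoin : ∀ i j, Linked H (p i) (p j) →
      JoinedIn (Set.range (γ i) ∪ Set.range (γ j) ∪ D.cluster H (p i))
        (R * Complex.exp (θ i * Complex.I)) (R * Complex.exp (θ j * Complex.I)) := by
    intro i j hij
    have hg : ∀ i, JoinedIn (Set.range (γ i)) (D.pt (p i)) (R * Complex.exp (θ i * Complex.I)) :=
      fun i => ⟨⟨γ i, hγ0 i, hγ1 i⟩, fun x => ⟨x, rfl⟩⟩
    refine (((hg i).symm.mono ?_).trans ((D.joinedIn_cluster hH hij).mono ?_)).trans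
      ((hg j).mono ?_)
    · exact Set.subset_union_left.trans Set.subset_union_left
    · exact Set.subset_union_right
    · exact Set.subset_union_right.trans Set.subset_union_left
  obtain ⟨z, hzA, hzB⟩ := JoinedIn.nonempty_inter_of_interlaced hRpos (hθ hab) (hθ hbc) (hθ hcd)
    (hθ' a d) (Set.union_subset (Set.union_subset (hrange a) (hrange c)) (hcl (p a)))
    (Set.union_subset (Set.union_subset (hrange b) (hrange d)) (hcl (p b)))
    (hjoin a c hac) (hjoin b d hbd)
  have hγcl : ∀ i u, z ∈ Set.range (γ i) → z ∈ D.cluster H u → Linked H u (p i) := by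
    rintro i u ⟨x, rfl⟩ hz
    by_cases hx : x = 0
    · rw [hx, hγ0] at hz
      exact D.linked_of_pt_mem_cluster hz
    · exact absurd (D.cluster_subset_drawing H u hz) (hγout i x hx).1
  have hγγ' : ∀ i j, i ≠ j → z ∈ Set.range (γ i) → z ∈ Set.range (γ j) → p i = p j := by
    rintro i j hij ⟨x, rfl⟩ ⟨y, hy⟩
    obtain ⟨rfl, rfl⟩ := hγγ i j hij x y hy.symm
    rw [hγ0, hγ0] at hy
    exact (D.pt_injective hy).symm
  have hend : ∀ i j, i ≠ j → z ∈ Set.range (γ i) → z ∈ Set.range (γ j) →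
      Linked H (p i) (p j) := fun i j hij hi hj => hγγ' i j hij hi hj ▸ Linked.refl H _
  rcases hzA with (hz | hz) | hz <;> rcases hzB with (hz' | hz') | hz'
  · exact hend a b hab.ne hz hz'
  · exact (hend a d (hab.trans (hbc.trans hcd)).ne hz hz').trans hbd.symm
  · exact (hγcl a _ hz hz').symm
  · exact hac.trans (hend c b hbc.ne' hz hz')
  · exact (hac.trans (hend c d hcd.ne hz hz')).trans hbd.symm
  · exact hac.trans (hγcl c _ hz hz').symm
  · exact hγcl b _ hz' hz
  · exact (hγcl d _ hz' hz).trans hbd.symm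
  · exact D.linked_of_mem_cluster hz hz'

end PlaneEmbedding

end Clusters

/-! ### Signs of shuffles and non-crossing partitions -/

section Signs

variable {ι Q : Type*}

/-- The number of elements of `S` in each class of `κ` is even. -/
def EvenOn [DecidableEq Q] (κ : ι → Q) (S : Finset ι) : Prop :=
  ∀ q, Even (S.filter fun i => κ i = q).card

/-- A part of `S` that is a union of even classes has an even number of elements. -/
theorem even_card_filter [DecidableEq Q] {κ : ι → Q} {S : Finset ι} {T : ι → Prop} [DecidablePred T]
    (heven : ∀ i ∈ S, T i → Even (S.filter fun j => κ j = κ i).card)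
    (hT : ∀ i ∈ S, ∀ j ∈ S, κ i = κ j → T i → T j) : Even (S.filter T).card := by
  rw [Finset.card_eq_sum_card_image κ]
  refine Finset.even_sum _ fun q hq => ?_
  obtain ⟨i, hi, rfl⟩ := Finset.mem_image.mp hq
  rw [Finset.mem_filter] at hi
  have he : (S.filter T).filter (fun j => κ j = κ i) = S.filter fun j => κ j = κ i := ?_
  · rw [he]; exact heven i hi.1 hi.2
  ext j
  simp only [Finset.mem_filter]
  exact ⟨fun h => ⟨h.1.1, h.2⟩, fun h => ⟨⟨h.1, hT i hi.1 j h.1 h.2.symm hi.2⟩, h.2⟩⟩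

variable [LinearOrder ι]

/-- The sign of the order in which two distinct nodes come. -/
def orderSign (i j : ι) : ℂ := if i < j then 1 else -1

theorem orderSign_of_lt {i j : ι} (h : i < j) : orderSign i j = 1 := if_pos h

theorem orderSign_of_gt {i j : ι} (h : j < i) : orderSign i j = -1 := if_neg h.not_gt

theorem orderSign_swap {i j : ι} (h : i ≠ j) : orderSign i j = -orderSign j i := by
  rcases h.lt_or_gt with h | h
  · rw [orderSign_of_lt h, orderSign_of_gt h, neg_neg]
  · rw [orderSign_of_lt h, orderSign_of_gt h]

/-- The sign of the permutation that moves `i` in front of `S`. -/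
def frontSign (i : ι) (S : Finset ι) : ℂ := ∏ j ∈ S, orderSign i j

/-- The sign of the permutation that moves `S` in front of `R`. -/
def shuffleSign (S R : Finset ι) : ℂ := ∏ i ∈ S, frontSign i R

theorem frontSign_insert {i j : ι} {S : Finset ι} (h : j ∉ S) :
    frontSign i (insert j S) = orderSign i j * frontSign i S := Finset.prod_insert h

theorem frontSign_union {i : ι} {S R : Finset ι} (h : Disjoint S R) :
    frontSign i (S ∪ R) = frontSign i S * frontSign i R := Finset.prod_union h

theorem frontSign_of_lt {i : ι} {S : Finset ι} (h : ∀ j ∈ S, i < j) : frontSign i S = 1 :=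
  Finset.prod_eq_one fun j hj => orderSign_of_lt (h j hj)

theorem shuffleSign_insert_left {i : ι} {S R : Finset ι} (h : i ∉ S) :
    shuffleSign (insert i S) R = frontSign i R * shuffleSign S R := Finset.prod_insert h

theorem shuffleSign_insert_right {i : ι} {S R : Finset ι} (h : i ∉ R) :
    shuffleSign S (insert i R) = (∏ j ∈ S, orderSign j i) * shuffleSign S R := by
  simp only [shuffleSign, frontSign_insert h, Finset.prod_mul_distrib]

/-- The classes of `κ` do not cross. -/
def NonCrossing (κ : ι → Q) : Prop :=
  ∀ ⦃a b c d : ι⦄, a < b → b < c → c < d → κ a = κ c → κ b = κ d → κ a = κ b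

variable [DecidableEq Q] {κ : ι → Q}

theorem EvenOn.sdiff {P S : Finset ι} (hP : EvenOn κ P) (hS : EvenOn κ S) (h : S ⊆ P) :
    EvenOn κ (P \ S) := by
  intro q
  have hsub : S.filter (fun i => κ i = q) ⊆ P.filter fun i => κ i = q :=
    Finset.filter_subset_filter _ h
  have hcard := Finset.card_sdiff_add_card_eq_card hsub
  have he : (P \ S).filter (fun i => κ i = q)
      = P.filter (fun i => κ i = q) \ S.filter fun i => κ i = q := by
    ext i; simp only [Finset.mem_filter, Finset.mem_sdiff]; tauto
  rw [← he] at hcard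
  have h1 := hP q
  rw [← hcard] at h1
  exact (Nat.even_add.mp h1).mpr (hS q)

theorem evenOn_pair_iff {a b : ι} (hab : a ≠ b) : EvenOn κ {a, b} ↔ κ a = κ b := by
  constructor
  · intro h
    by_contra hne
    have := h (κ a)
    rw [Finset.filter_insert, if_pos rfl, Finset.filter_singleton, if_neg (Ne.symm hne)] at this
    simp at this
  · intro h q
    rw [Finset.filter_insert, Finset.filter_singleton, h]
    split_ifs with hq
    · rw [Finset.card_pair hab]; exact even_two
    · simp

theorem evenOn_insert_insert {a b : ι} (hab : a ≠ b) (hκ : κ a = κ b) {S : Finset ι} (ha : a ∉ S)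
    (hb : b ∉ S) : EvenOn κ (insert a (insert b S)) ↔ EvenOn κ S := by
  have hab' : a ∉ insert b S := by simp [hab, ha]
  have hsub : ({a, b} : Finset ι) ⊆ insert a (insert b S) := by
    intro i; simp only [Finset.mem_insert, Finset.mem_singleton]; tauto
  have he : insert a (insert b S) \ {a, b} = S := by
    ext i; simp only [Finset.mem_sdiff, Finset.mem_insert, Finset.mem_singleton]
    constructor
    · tauto
    · intro hi
      exact ⟨Or.inr (Or.inr hi), by rintro (rfl | rfl) <;> contradiction⟩
  constructor
  · intro h
    rw [← he]
    exact h.sdiff ((evenOn_pair_iff hab).mpr hκ) hsub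
  · intro h q
    have h1 := h q
    have h2 := (evenOn_pair_iff hab).mpr hκ q
    have : insert a (insert b S) = {a, b} ∪ S := by ext i; simp
    rw [this, Finset.filter_union, Finset.card_union_of_disjoint]
    · exact h2.add h1
    · refine Finset.disjoint_filter_filter ?_
      rw [Finset.disjoint_left]; intro i hi
      simp only [Finset.mem_insert, Finset.mem_singleton] at hi
      rcases hi with rfl | rfl <;> assumption

theorem evenOn_insert_congr {a b : ι} (hκ : κ a = κ b) {S : Finset ι} (ha : a ∉ S)
    (hb : b ∉ S) : EvenOn κ (insert a S) ↔ EvenOn κ (insert b S) := by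
  refine forall_congr' fun q => ?_
  rw [Finset.filter_insert, Finset.filter_insert, hκ]
  split_ifs with hq
  · rw [Finset.card_insert_of_notMem (by simp [ha]), Finset.card_insert_of_notMem (by simp [hb])]
  · rfl

/-- Moving two consecutive members of one class past an even set costs no sign. -/
theorem prod_orderSign_pair (hκ : NonCrossing κ) {a b : ι} (hab : a < b) (hκab : κ a = κ b)
    {S : Finset ι} (ha : a ∉ S) (hb : b ∉ S)
    (hS : ∀ q, q ≠ κ a → Even (S.filter fun j => κ j = q).card)
    (hbetween : ∀ i ∈ S, a < i → i < b → κ i ≠ κ a) :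
    ∏ i ∈ S, orderSign i a * orderSign i b = 1 := by
  have h1 : ∏ i ∈ S, orderSign i a * orderSign i b
      = ∏ i ∈ S, if a < i ∧ i < b then (-1 : ℂ) else 1 := by
    refine Finset.prod_congr rfl fun i hi => ?_
    have hia : i ≠ a := fun h => ha (h ▸ hi)
    have hib : i ≠ b := fun h => hb (h ▸ hi)
    rcases hia.lt_or_gt with h | h
    · rw [orderSign_of_lt h, orderSign_of_lt (h.trans hab), if_neg (fun h' => h'.1.not_gt h),
        one_mul]
    · rcases hib.lt_or_gt with h' | h'
      · rw [orderSign_of_gt h, orderSign_of_lt h', if_pos ⟨h, h'⟩, mul_one]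
      · rw [orderSign_of_gt h, orderSign_of_gt h', if_neg (fun h'' => h''.2.not_gt h')]
        norm_num
  rw [h1, Finset.prod_ite, Finset.prod_const, Finset.prod_const_one, mul_one]
  refine Even.neg_one_pow (even_card_filter (κ := κ) (fun i hi h => hS _ (hbetween i hi h.1 h.2)) ?_)
  intro i hi j hj hij ⟨hai, hib⟩
  have hja : j ≠ a := fun h => ha (h ▸ hj)
  have hjb : j ≠ b := fun h => hb (h ▸ hj)
  have hne := hbetween i hi hai hib
  refine ⟨hja.lt_or_gt.resolve_left fun h => hne ?_, hjb.lt_or_gt.resolve_right fun h => hne ?_⟩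
  · exact hij.trans (hκ h hai hib hij.symm hκab)
  · exact (hκ hai hib h hκab hij).symm

theorem frontSign_mul_frontSign_pair (hκ : NonCrossing κ) {a b : ι} (hab : a < b)
    (hκab : κ a = κ b) {S : Finset ι} (ha : a ∉ S) (hb : b ∉ S)
    (hS : ∀ q, q ≠ κ a → Even (S.filter fun j => κ j = q).card)
    (hbetween : ∀ i ∈ S, a < i → i < b → κ i ≠ κ a) :
    frontSign a S * frontSign b S = 1 := by
  rw [← prod_orderSign_pair hκ hab hκab ha hb hS hbetween, frontSign, frontSign,
    ← Finset.prod_mul_distrib]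
  refine Finset.prod_congr rfl fun i hi => ?_
  rw [orderSign_swap (fun h => ha (h ▸ hi) : a ≠ i), orderSign_swap (fun h => hb (h ▸ hi) : b ≠ i),
    neg_mul_neg]

theorem sum_powerset_insert_sdiff {M : Type*} [AddCommMonoid M] {a : ι} {P : Finset ι} (ha : a ∉ P)
    (f : Finset ι → Finset ι → M) :
    ∑ S ∈ (insert a P).powerset, f S (insert a P \ S)
      = ∑ S ∈ P.powerset, (f S (insert a (P \ S)) + f (insert a S) (P \ S)) := by
  rw [Finset.sum_powerset_insert ha, ← Finset.sum_add_distrib]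
  refine Finset.sum_congr rfl fun S hS => ?_
  have haS : a ∉ S := fun h => ha (Finset.mem_powerset.mp hS h)
  rw [Finset.insert_sdiff_of_notMem _ haS, Finset.insert_sdiff_insert, Finset.sdiff_insert,
    Finset.erase_eq_of_notMem (by simp [ha])]

/-- The signed number of ways to split `P` in two parts which are both even on every class. -/
def signedSplits (κ : ι → Q) (η : ι → ℂ) (P : Finset ι) : ℂ :=
  open Classical in
  ∑ S ∈ P.powerset, if EvenOn κ (P \ S) then shuffleSign S (P \ S) * ∏ i ∈ P \ S, η i else 0

/-- Splits cancel in pairs if two consecutive members of a class are of the same type. -/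
theorem signedSplits_eq_zero_of_consecutive (hκ : NonCrossing κ) {η : ι → ℂ} {P : Finset ι}
    (hP : EvenOn κ P) {a b : ι} (ha : a ∈ P) (hb : b ∈ P) (hab : a < b) (hκab : κ a = κ b)
    (hη : η a = η b) (hη2 : η a * η b = -1)
    (hbetween : ∀ i ∈ P, a < i → i < b → κ i ≠ κ a) : signedSplits κ η P = 0 := by
  classical
  obtain ⟨P', hbP', haP', rfl⟩ : ∃ P', b ∉ P' ∧ a ∉ insert b P' ∧ P = insert a (insert b P') :=
    ⟨(P.erase a).erase b, by simp, by simp [hab.ne], by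
      rw [Finset.insert_erase (by simp [hb, hab.ne']), Finset.insert_erase ha]⟩
  have haP : a ∉ P' := fun h => haP' (by simp [h])
  rw [signedSplits, sum_powerset_insert_sdiff haP' fun S R =>
    if EvenOn κ R then shuffleSign S R * ∏ i ∈ R, η i else 0, Finset.sum_add_distrib,
    sum_powerset_insert_sdiff hbP' fun S R =>
    if EvenOn κ (insert a R) then shuffleSign S (insert a R) * ∏ i ∈ insert a R, η i else 0,
    sum_powerset_insert_sdiff hbP' fun S R =>
    if EvenOn κ R then shuffleSign (insert a S) R * ∏ i ∈ R, η i else 0,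
    ← Finset.sum_add_distrib]
  refine Finset.sum_eq_zero fun S hS => ?_
  have hSP := Finset.mem_powerset.mp hS
  set R := P' \ S with hR
  have haS : a ∉ S := fun h => haP (hSP h)
  have hbS : b ∉ S := fun h => hbP' (hSP h)
  have haR : a ∉ R := fun h => haP (Finset.sdiff_subset h)
  have hbR : b ∉ R := fun h => hbP' (Finset.sdiff_subset h)
  have habR : a ∉ insert b R := by simp [hab.ne, haR]
  have habS : a ∉ insert b S := by simp [hab.ne, haS]
  have hSbetween : ∀ i ∈ S, a < i → i < b → κ i ≠ κ a := fun i hi =>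
    hbetween i (by simp [hSP hi])
  have hRbetween : ∀ i ∈ R, a < i → i < b → κ i ≠ κ a := fun i hi =>
    hbetween i (by simp [Finset.sdiff_subset hi])
  have hP' : EvenOn κ P' := (evenOn_insert_insert hab.ne hκab haP hbP').mp hP
  have hcount : ∀ q, (S.filter fun i => κ i = q).card + (R.filter fun i => κ i = q).card
      = (P'.filter fun i => κ i = q).card := by
    intro q
    rw [← Finset.card_union_of_disjoint (Finset.disjoint_filter_filter Finset.disjoint_sdiff),
      ← Finset.filter_union, Finset.union_sdiff_of_subset hSP]
  have hSeven : (∀ q, q ≠ κ a → Even (R.filter fun i => κ i = q).card) →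
      ∀ q, q ≠ κ a → Even (S.filter fun i => κ i = q).card := by
    intro h q hq
    have h1 := hP' q
    rw [← hcount] at h1
    exact (Nat.even_add.mp h1).mpr (h q hq)
  rw [evenOn_insert_insert hab.ne hκab haR hbR, ← evenOn_insert_congr hκab haR hbR]
  have key : (∀ q, q ≠ κ a → Even (R.filter fun i => κ i = q).card) →
      (frontSign a R * frontSign b R = 1) ∧
      (∏ i ∈ S, orderSign i a) * (∏ i ∈ S, orderSign i b) = 1 := fun h =>
    ⟨frontSign_mul_frontSign_pair hκ hab hκab haR hbR h hRbetween, by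
      rw [← Finset.prod_mul_distrib]
      exact prod_orderSign_pair hκ hab hκab haS hbS (hSeven h) hSbetween⟩
  have e1 : (if EvenOn κ R then shuffleSign S (insert a (insert b R)) *
        ∏ i ∈ insert a (insert b R), η i else 0)
      + (if EvenOn κ R then shuffleSign (insert a (insert b S)) R * ∏ i ∈ R, η i else 0) = 0 := by
    by_cases hev : EvenOn κ R
    · obtain ⟨k1, k2⟩ := key fun q _ => hev q
      rw [if_pos hev, if_pos hev, shuffleSign_insert_right habR, shuffleSign_insert_right hbR,
        shuffleSign_insert_left habS, shuffleSign_insert_left hbS, Finset.prod_insert habR,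
        Finset.prod_insert hbR]
      linear_combination (shuffleSign S R * ∏ i ∈ R, η i) * ((∏ i ∈ S, orderSign i a) *
        (∏ i ∈ S, orderSign i b) * hη2 - k2 + k1)
    · rw [if_neg hev, if_neg hev, add_zero]
  have e2 : (if EvenOn κ (insert a R) then shuffleSign (insert b S) (insert a R) *
        ∏ i ∈ insert a R, η i else 0)
      + (if EvenOn κ (insert a R) then shuffleSign (insert a S) (insert b R) *
        ∏ i ∈ insert b R, η i else 0) = 0 := by
    by_cases hev : EvenOn κ (insert a R)
    · obtain ⟨k1, k2⟩ := key fun q hq => by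
        have := hev q
        rwa [Finset.filter_insert, if_neg hq.symm] at this
      rw [if_pos hev, if_pos hev, shuffleSign_insert_left hbS, shuffleSign_insert_left haS,
        shuffleSign_insert_right haR, shuffleSign_insert_right hbR, frontSign_insert haR,
        frontSign_insert hbR, Finset.prod_insert haR, Finset.prod_insert hbR, hη,
        orderSign_of_lt hab, orderSign_of_gt hab]
      have sq : ∀ (f : ι → ℂ) (T : Finset ι), (∀ i ∈ T, f i = 1 ∨ f i = -1) →
          (∏ i ∈ T, f i) * (∏ i ∈ T, f i) = 1 := by
        intro f T hf
        rw [← Finset.prod_mul_distrib]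
        refine Finset.prod_eq_one fun i hi => ?_
        rcases hf i hi with h | h <;> rw [h] <;> norm_num
      have hos : ∀ i j : ι, orderSign i j = 1 ∨ orderSign i j = -1 := fun i j => by
        unfold orderSign; split_ifs <;> simp
      have q1 : frontSign a R = frontSign b R := by
        have := sq (orderSign b) R fun i _ => hos b i
        change frontSign b R * frontSign b R = 1 at this
        linear_combination (frontSign b R) * k1 - (frontSign a R) * this
      have q2 : (∏ i ∈ S, orderSign i a) = ∏ i ∈ S, orderSign i b := by
        have := sq (fun i => orderSign i b) S fun i _ => hos i b
        linear_combination (∏ i ∈ S, orderSign i b) * k2 - (∏ i ∈ S, orderSign i a) * this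
      rw [q1, q2]
      ring
    · rw [if_neg hev, if_neg hev, add_zero]
  linear_combination e1 + e2

/-- Splits cancel if two members of a class are of the same type. -/
theorem signedSplits_eq_zero (hκ : NonCrossing κ) {η : ι → ℂ} (hη2 : ∀ i, η i * η i = -1)
    (hηconv : ∀ a b c, a < b → b < c → η a = η c → η b = η a) {P : Finset ι}
    (hP : EvenOn κ P) {a b : ι} (ha : a ∈ P) (hb : b ∈ P) (hab : a < b) (hκab : κ a = κ b)
    (hη : η a = η b) : signedSplits κ η P = 0 := by
  induction hm : (P.filter fun i => a < i ∧ i < b).card using Nat.strong_induction_on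
    generalizing b with
  | _ m ih =>
    by_cases hex : ∃ i ∈ P, a < i ∧ i < b ∧ κ i = κ a
    · obtain ⟨i, hi, hai, hib, hκi⟩ := hex
      refine ih _ ?_ hi hai hκi.symm (hηconv a i b hai hib hη).symm rfl
      rw [← hm]
      refine Finset.card_lt_card ?_
      refine (Finset.ssubset_iff_of_subset ?_).mpr ⟨i, ?_, ?_⟩
      · intro j
        simp only [Finset.mem_filter]
        exact fun h => ⟨h.1, h.2.1, h.2.2.trans hib⟩
      · simp [hi, hai, hib]
      · simp
    · push Not at hex
      exact signedSplits_eq_zero_of_consecutive hκ hP ha hb hab hκab hη (hη ▸ hη2 a) hex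

/-- If each class consists of one node of each type, then every split counts with a plus sign. -/
theorem shuffleSign_mul_prod_eq_one (hκ : NonCrossing κ) {η : ι → ℂ} {P : Finset ι}
    (hη : ∀ a ∈ P, ∀ b ∈ P, κ a = κ b → a ≠ b → η a * η b = 1) (hη2 : ∀ i, η i * η i = -1)
    {S : Finset ι} (hS : EvenOn κ S) (hSP : S ⊆ P) (R : Finset ι) (hR : EvenOn κ R) (hRP : R ⊆ P)
    (hSR : Disjoint S R) : shuffleSign S R * ∏ i ∈ R, η i = 1 := by
  induction hm : R.card using Nat.strong_induction_on generalizing R with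
  | _ m ih =>
    rcases R.eq_empty_or_nonempty with rfl | ⟨a, ha⟩
    · simp [shuffleSign, frontSign]
    · have hone : ((R.filter fun i => κ i = κ a).erase a).Nonempty := by
        rw [← Finset.card_pos, Finset.card_erase_of_mem (by simp [ha])]
        have h0 : 0 < (R.filter fun i => κ i = κ a).card := Finset.card_pos.mpr ⟨a, by simp [ha]⟩
        obtain ⟨c, hc⟩ := hR (κ a)
        omega
      obtain ⟨b, hb⟩ := hone
      simp only [Finset.mem_erase, Finset.mem_filter] at hb
      obtain ⟨hba, hbR, hκb⟩ := hb
      wlog hab : a < b generalizing a b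
      · exact this b hbR a hba.symm ha hκb.symm (lt_of_le_of_ne (not_lt.mp hab) hba)
      obtain ⟨R', hbR', haR', rfl⟩ : ∃ R', b ∉ R' ∧ a ∉ insert b R' ∧ R = insert a (insert b R') :=
        ⟨(R.erase a).erase b, by simp, by simp [hab.ne], by
          rw [Finset.insert_erase (by simp [hbR, hab.ne']), Finset.insert_erase ha]⟩
      have haR : a ∉ R' := fun h => haR' (by simp [h])
      have hSab : a ∉ S ∧ b ∉ S :=
        ⟨Finset.disjoint_right.mp hSR ha, Finset.disjoint_right.mp hSR hbR⟩
      have h1 := ih R'.card (by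
          rw [← hm, Finset.card_insert_of_notMem haR', Finset.card_insert_of_notMem hbR']; omega)
        R' ((evenOn_insert_insert hab.ne hκb.symm haR hbR').mp hR)
        (fun i hi => hRP (by simp [hi]))
        (hSR.mono_right fun i hi => by simp [hi]) rfl
      have hab1 := hη a (hRP ha) b (hRP hbR) hκb.symm hab.ne
      have h2 := prod_orderSign_pair hκ hab hκb.symm hSab.1 hSab.2 (fun q _ => hS q) (by
        intro i hi hai hib hia
        have hi1 := hη a (hRP ha) i (hSP hi) hia.symm hai.ne
        have hi2 := hη b (hRP hbR) i (hSP hi) (hκb.trans hia.symm) hib.ne'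
        have hia2 := hη2 a
        have hib2 := hη2 b
        have e1 : η i = -η a := by linear_combination (-η a) * hi1 + η i * hia2
        have e2 : η i = -η b := by linear_combination (-η b) * hi2 + η i * hib2
        have e3 : η a = η b := by linear_combination e1 - e2
        rw [e3, hib2] at hab1
        norm_num at hab1)
      rw [Finset.prod_mul_distrib] at h2
      rw [shuffleSign_insert_right haR', shuffleSign_insert_right hbR', Finset.prod_insert haR',
        Finset.prod_insert hbR']
      linear_combination (shuffleSign S R' * ∏ i ∈ R', η i) * (η a * η b * h2 + hab1) + h1

theorem exists_signedSplits_eq_natCast (hκ : NonCrossing κ) {η : ι → ℂ} {P : Finset ι}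
    (hP : EvenOn κ P) (hη : ∀ a ∈ P, ∀ b ∈ P, κ a = κ b → a ≠ b → η a * η b = 1)
    (hη2 : ∀ i, η i * η i = -1) : ∃ m : ℕ, 0 < m ∧ signedSplits κ η P = m := by
  classical
  refine ⟨(P.powerset.filter fun S => EvenOn κ (P \ S)).card,
    Finset.card_pos.mpr ⟨∅, by simpa using hP⟩, ?_⟩
  rw [signedSplits, ← Finset.sum_filter, Finset.sum_congr rfl fun S hS => ?_, Finset.sum_const,
    nsmul_eq_mul, mul_one]
  rw [Finset.mem_filter, Finset.mem_powerset] at hS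
  refine shuffleSign_mul_prod_eq_one hκ hη hη2 ?_ hS.1 _ hS.2 Finset.sdiff_subset
    Finset.disjoint_sdiff
  have := hP.sdiff hS.2 Finset.sdiff_subset
  rwa [Finset.sdiff_sdiff_eq_self hS.1] at this

end Signs

/-! ### Wick's rule and determinants -/

section Wick

variable {ι : Type*} [LinearOrder ι]

/-- Wick's rule: expansion of a multi-point function along its first node. -/
def IsWick (φ : Finset ι → ℂ) : Prop :=
  ∀ (a : ι) (S : Finset ι), (∀ i ∈ S, a < i) →
    φ (insert a S) = ∑ j ∈ S, frontSign j (S.erase j) * φ {a, j} * φ (S.erase j)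

/-- The signed sum, over all splits of `P` in two parts, of the product of the two multi-point
functions. -/
def splitSum (φ : Finset ι → ℂ) (η : ι → ℂ) (P : Finset ι) : ℂ :=
  ∑ S ∈ P.powerset, shuffleSign S (P \ S) * (∏ i ∈ P \ S, η i) * (φ S * φ (P \ S))

theorem sum_powerset_sum_mem (P : Finset ι) (f : ι → Finset ι → Finset ι → ℂ) :
    ∑ S ∈ P.powerset, ∑ j ∈ S, f j (S.erase j) (P \ S)
      = ∑ j ∈ P, ∑ S ∈ (P.erase j).powerset, f j S (P.erase j \ S) := by
  rw [Finset.sum_comm' (t' := P) (s' := fun j => P.powerset.filter fun S => j ∈ S)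
    (fun S j => by
      simp only [Finset.mem_powerset, Finset.mem_filter]
      exact ⟨fun h => ⟨h, h.1 h.2⟩, fun h => h.1⟩)]
  refine Finset.sum_congr rfl fun j hj => ?_
  rw [Finset.sum_filter]
  conv_lhs => rw [← Finset.insert_erase hj]
  rw [sum_powerset_insert_sdiff (Finset.notMem_erase j P)
    fun S R => if j ∈ S then f j (S.erase j) R else 0]
  refine Finset.sum_congr rfl fun S hS => ?_
  have hjS : j ∉ S := fun h => Finset.notMem_erase j P (Finset.mem_powerset.mp hS h)
  rw [if_neg hjS, if_pos (Finset.mem_insert_self j S), Finset.erase_insert hjS, zero_add]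

theorem sum_powerset_sum_mem_sdiff (P : Finset ι) (f : ι → Finset ι → Finset ι → ℂ) :
    ∑ S ∈ P.powerset, ∑ j ∈ P \ S, f j S ((P \ S).erase j)
      = ∑ j ∈ P, ∑ S ∈ (P.erase j).powerset, f j S (P.erase j \ S) := by
  rw [Finset.sum_comm' (t' := P) (s' := fun j => P.powerset.filter fun S => j ∉ S)
    (fun S j => by
      simp only [Finset.mem_powerset, Finset.mem_filter, Finset.mem_sdiff]
      tauto)]
  refine Finset.sum_congr rfl fun j hj => ?_
  rw [Finset.sum_filter]
  conv_lhs => rw [← Finset.insert_erase hj]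
  rw [sum_powerset_insert_sdiff (Finset.notMem_erase j P)
    fun S R => if j ∉ S then f j S (R.erase j) else 0]
  refine Finset.sum_congr rfl fun S hS => ?_
  have hjS : j ∉ S := fun h => Finset.notMem_erase j P (Finset.mem_powerset.mp hS h)
  rw [if_pos hjS, if_neg (not_not.mpr (Finset.mem_insert_self j S)), Finset.erase_insert (by simp),
    add_zero]

theorem frontSign_mul_frontSign_sdiff {P S : Finset ι} (j : ι) (h : S ⊆ P) :
    frontSign j S * frontSign j (P \ S) = frontSign j P := by
  rw [← frontSign_union Finset.disjoint_sdiff, Finset.union_sdiff_of_subset h]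

/-- Expansion of a signed split sum along its first node. -/
theorem IsWick.splitSum_insert {φ : Finset ι → ℂ} (hφ : IsWick φ) (η : ι → ℂ) {a : ι}
    {P : Finset ι} (ha : ∀ i ∈ P, a < i) :
    splitSum φ η (insert a P)
      = ∑ j ∈ P, (1 + η a * η j) * (frontSign j (P.erase j) * φ {a, j}) *
          splitSum φ η (P.erase j) := by
  have haP : a ∉ P := fun h => (ha a h).false
  rw [splitSum, sum_powerset_insert_sdiff haP fun S R =>
    shuffleSign S R * (∏ i ∈ R, η i) * (φ S * φ R), Finset.sum_add_distrib]
  have h1 : ∑ S ∈ P.powerset, shuffleSign (insert a S) (P \ S) * (∏ i ∈ P \ S, η i) *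
      (φ (insert a S) * φ (P \ S))
      = ∑ j ∈ P, ∑ S ∈ (P.erase j).powerset, frontSign j (P.erase j) * φ {a, j} *
        (shuffleSign S (P.erase j \ S) * (∏ i ∈ P.erase j \ S, η i) *
          (φ S * φ (P.erase j \ S))) := by
    have e := sum_powerset_sum_mem P fun j S R =>
      (frontSign j S * frontSign j R) * φ {a, j} *
        (shuffleSign S R * (∏ i ∈ R, η i) * (φ S * φ R))
    refine Eq.trans ?_ (e.trans ?_)
    · refine Finset.sum_congr rfl fun S hS => ?_
      have hSP := Finset.mem_powerset.mp hS
      rw [hφ a S fun i hi => ha i (hSP hi),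
        shuffleSign_insert_left (fun h => haP (hSP h)),
        frontSign_of_lt fun j hj => ha j (Finset.sdiff_subset hj), Finset.sum_mul, Finset.mul_sum]
      refine Finset.sum_congr rfl fun j hj => ?_
      have : shuffleSign S (P \ S) = frontSign j (P \ S) * shuffleSign (S.erase j) (P \ S) := by
        rw [← shuffleSign_insert_left (Finset.notMem_erase j S), Finset.insert_erase hj]
      rw [this]; ring
    · refine Finset.sum_congr rfl fun j hj => Finset.sum_congr rfl fun S hS => ?_
      rw [frontSign_mul_frontSign_sdiff j (Finset.mem_powerset.mp hS)]
  have h2 : ∑ S ∈ P.powerset, shuffleSign S (insert a (P \ S)) * (∏ i ∈ insert a (P \ S), η i) *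
      (φ S * φ (insert a (P \ S)))
      = ∑ j ∈ P, ∑ S ∈ (P.erase j).powerset, η a * η j * (frontSign j (P.erase j) * φ {a, j}) *
        (shuffleSign S (P.erase j \ S) * (∏ i ∈ P.erase j \ S, η i) *
          (φ S * φ (P.erase j \ S))) := by
    have e := sum_powerset_sum_mem_sdiff P fun j S R =>
      η a * η j * ((frontSign j S * frontSign j R) * φ {a, j}) *
        (shuffleSign S R * (∏ i ∈ R, η i) * (φ S * φ R))
    refine Eq.trans ?_ (e.trans ?_)
    · refine Finset.sum_congr rfl fun S hS => ?_
      have hSP := Finset.mem_powerset.mp hS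
      have haR : a ∉ P \ S := fun h => haP (Finset.sdiff_subset h)
      rw [hφ a (P \ S) fun i hi => ha i (Finset.sdiff_subset hi),
        shuffleSign_insert_right haR, Finset.prod_insert haR, Finset.mul_sum, Finset.mul_sum]
      refine Finset.sum_congr rfl fun j hj => ?_
      have hjS : j ∉ S := (Finset.mem_sdiff.mp hj).2
      have h3 : shuffleSign S (P \ S)
          = (∏ i ∈ S, orderSign i j) * shuffleSign S ((P \ S).erase j) := by
        rw [← shuffleSign_insert_right (Finset.notMem_erase j _), Finset.insert_erase hj]
      have h4 : (∏ i ∈ S, orderSign i a) * (∏ i ∈ S, orderSign i j) = frontSign j S := by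
        rw [← Finset.prod_mul_distrib]
        refine Finset.prod_congr rfl fun i hi => ?_
        rw [orderSign_of_gt (ha i (hSP hi)), orderSign_swap (fun h => hjS (h ▸ hi) : j ≠ i)]
        ring
      have h5 : ∏ i ∈ P \ S, η i = η j * ∏ i ∈ (P \ S).erase j, η i :=
        (Finset.mul_prod_erase _ _ hj).symm
      rw [h3, h5, ← h4]; ring
    · refine Finset.sum_congr rfl fun j hj => Finset.sum_congr rfl fun S hS => ?_
      rw [frontSign_mul_frontSign_sdiff j (Finset.mem_powerset.mp hS)]
  rw [h1, h2, ← Finset.sum_add_distrib]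
  refine Finset.sum_congr rfl fun j hj => ?_
  rw [← Finset.sum_add_distrib, splitSum, Finset.mul_sum]
  exact Finset.sum_congr rfl fun S hS => by ring

theorem prod_ite_lt_castSucc {k : ℕ} (j : Fin (k + 1)) :
    ∏ m : Fin k, (if m.castSucc < j then (-1 : ℂ) else 1) = (-1) ^ (j : ℕ) := by
  rw [Finset.prod_ite, Finset.prod_const, Finset.prod_const_one, mul_one]
  congr 1
  have : (Finset.univ.filter fun m : Fin k => m.castSucc < j).image Fin.val
      = Finset.range j := by
    ext i
    simp only [Finset.mem_image, Finset.mem_filter, Finset.mem_univ, true_and, Finset.mem_range,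
      Fin.lt_def, Fin.val_castSucc]
    exact ⟨by rintro ⟨m, hm, rfl⟩; exact hm, fun h => ⟨⟨i, by omega⟩, h, rfl⟩⟩
  rw [← Finset.card_image_of_injective _ Fin.val_injective, this, Finset.card_range]

/-- For nodes `x 0 < … < x (k-1) < y (k-1) < … < y 0` the signed split sum is a determinant of
two-point functions. -/
theorem IsWick.splitSum_eq_det {φ : Finset ι → ℂ} (hφ : IsWick φ) (hφ0 : φ ∅ = 1) {η : ι → ℂ}
    {k : ℕ} {x y : Fin k → ι} (hx : StrictMono x) (hy : StrictAnti y) (hxy : ∀ i j, x i < y j)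
    (hηx : ∀ i, η (x i) = Complex.I) (hηy : ∀ j, η (y j) = -Complex.I) :
    splitSum φ η (Finset.univ.image x ∪ Finset.univ.image y)
      = 2 ^ k * (Matrix.of fun i j => φ {x i, y j}).det := by
  induction k with
  | zero => simp [splitSum, shuffleSign, hφ0]
  | succ k ih =>
    set X := Finset.univ.image fun i => x (Fin.succ i) with hX
    set Y := Finset.univ.image y with hY
    have hP : Finset.univ.image x ∪ Y = insert (x 0) (X ∪ Y) := by
      ext i
      simp only [hX, Finset.mem_union, Finset.mem_insert, Finset.mem_image, Finset.mem_univ,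
        true_and, Fin.exists_fin_succ, eq_comm, or_assoc]
    have hdisj : ∀ {m : ℕ} (f : Fin m → Fin (k + 1)) (g : Fin m → Fin (k + 1)),
        Disjoint (Finset.univ.image fun i => x (f i)) (Finset.univ.image fun i => y (g i)) := by
      intro m f g
      simp only [Finset.disjoint_left, Finset.mem_image, Finset.mem_univ, true_and]
      rintro _ ⟨i, rfl⟩ ⟨j, h⟩
      exact (hxy (f i) (g j)).ne' h
    have hXY : Disjoint X Y := by
      simp only [hX, hY, Finset.disjoint_left, Finset.mem_image, Finset.mem_univ, true_and]
      rintro _ ⟨i, rfl⟩ ⟨j, h⟩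
      exact (hxy i.succ j).ne' h
    rw [hP, hφ.splitSum_insert η, Finset.sum_union hXY, hX,
      Finset.sum_image (fun i _ j _ h => Fin.succ_injective _ (hx.injective h)), ← hX,
      Finset.sum_eq_zero (s := Finset.univ), zero_add, hY,
      Finset.sum_image (fun i _ j _ h => hy.injective h), ← hY, Matrix.det_succ_row_zero,
      Finset.mul_sum]
    · refine Finset.sum_congr rfl fun j _ => ?_
      have herase : (X ∪ Y).erase (y j) = X ∪ Finset.univ.image fun m => y (j.succAbove m) := by
        ext i
        simp only [hX, hY, Finset.mem_erase, Finset.mem_union, Finset.mem_image, Finset.mem_univ,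
          true_and]
        constructor
        · rintro ⟨hne, h | ⟨m, rfl⟩⟩
          · exact Or.inl h
          · obtain ⟨m', rfl⟩ := Fin.exists_succAbove_eq (fun h => hne (h ▸ rfl) : m ≠ j)
            exact Or.inr ⟨m', rfl⟩
        · rintro (⟨m, rfl⟩ | ⟨m, rfl⟩)
          · exact ⟨(hxy _ _).ne, Or.inl ⟨m, rfl⟩⟩
          · exact ⟨fun h => Fin.succAbove_ne j m (hy.injective h), Or.inr ⟨_, rfl⟩⟩
      have hsign : frontSign (y j) ((X ∪ Y).erase (y j)) = (-1) ^ (j : ℕ) := by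
        rw [herase, frontSign_union (hdisj Fin.succ j.succAbove), frontSign, frontSign,
          Finset.prod_image (fun i _ m _ h => Fin.succ_injective _ (hx.injective h)),
          Finset.prod_image (fun i _ m _ h => Fin.succAbove_right_injective (hy.injective h)),
          ← Finset.prod_mul_distrib, ← prod_ite_lt_castSucc]
        refine Finset.prod_congr rfl fun m _ => ?_
        rw [orderSign_of_gt (hxy _ _), orderSign]
        simp only [hy.lt_iff_gt, Fin.succAbove_lt_iff_castSucc_lt]
        split_ifs <;> norm_num
      have hrec := ih (x := fun i => x i.succ) (y := fun m => y (j.succAbove m))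
        (hx.comp (Fin.strictMono_succ)) (hy.comp_strictMono (Fin.strictMono_succAbove j))
        (fun _ _ => hxy _ _) (fun _ => hηx _) (fun _ => hηy _)
      rw [hsign, herase, hrec, hηx, hηy, pow_succ]
      have : (1 + Complex.I * -Complex.I) = 2 := by
        rw [mul_neg, Complex.I_mul_I]; norm_num
      rw [this, Matrix.of_apply]
      have hsub : (Matrix.of fun i j => φ {x i, y j}).submatrix Fin.succ j.succAbove
          = Matrix.of fun i m => φ {x i.succ, y (j.succAbove m)} := rfl
      rw [hsub]
      ring
    · intro i _
      rw [hηx, hηx, Complex.I_mul_I]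
      ring
    · intro i hi
      simp only [hX, hY, Finset.mem_union, Finset.mem_image, Finset.mem_univ, true_and] at hi
      rcases hi with ⟨m, rfl⟩ | ⟨m, rfl⟩
      · exact hx (Fin.succ_pos m)
      · exact hxy _ _

/-! ### Wick's rule for one cluster structure -/

variable {Q : Type*} [DecidableEq Q] {κ : ι → Q}

theorem sum_neg_one_pow_card_lt (B : Finset ι) :
    ∑ j ∈ B, (-1 : ℂ) ^ (B.filter fun i => i < j).card = if Even B.card then 0 else 1 := by
  induction B using Finset.induction_on_max with
  | empty => simp
  | insert a B ha ih =>
    have haB : a ∉ B := fun h => (ha a h).false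
    rw [Finset.sum_insert haB, Finset.card_insert_of_notMem haB]
    simp only [Nat.even_add_one]
    have h1 : (insert a B).filter (fun i => i < a) = B := by
      ext i
      simp only [Finset.mem_filter, Finset.mem_insert]
      exact ⟨fun h => h.1.resolve_left h.2.ne, fun h => ⟨Or.inr h, ha i h⟩⟩
    have h2 : ∀ j ∈ B, (insert a B).filter (fun i => i < j) = B.filter fun i => i < j := by
      intro j hj
      rw [Finset.filter_insert, if_neg (ha j hj).not_gt]
    rw [h1, Finset.sum_congr rfl fun j hj => by rw [h2 j hj], ih]
    split_ifs with h
    · rw [h.neg_one_pow]; simp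
    · rw [(Nat.not_even_iff_odd.mp h).neg_one_pow]; simp

theorem sum_frontSign_of_nonCrossing (hκ : NonCrossing κ) {a : ι} {S : Finset ι}
    (ha : ∀ i ∈ S, a < i) (hS : EvenOn κ (insert a S)) :
    ∑ j ∈ S, frontSign j (S.erase j) * (if κ a = κ j then 1 else 0) = 1 := by
  have haS : a ∉ S := fun h => (ha a h).false
  simp only [mul_ite, mul_one, mul_zero]
  rw [← Finset.sum_filter]
  set B := S.filter fun j => κ a = κ j with hB
  have hodd : ¬ Even B.card := by
    have h1 := hS (κ a)
    rw [Finset.filter_insert, if_pos rfl, Finset.card_insert_of_notMem (by simp [haS]),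
      Nat.even_add_one] at h1
    simpa only [hB, eq_comm] using h1
  have h2 := sum_neg_one_pow_card_lt B
  rw [if_neg hodd] at h2
  rw [← h2]
  refine Finset.sum_congr rfl fun j hj => ?_
  rw [hB, Finset.mem_filter] at hj
  have h3 : frontSign j (S.erase j) = (-1) ^ (S.filter fun i => i < j).card := by
    have : frontSign j (S.erase j) = ∏ i ∈ S, if i < j then (-1 : ℂ) else 1 := by
      rw [← Finset.mul_prod_erase S _ hj.1, if_neg (lt_irrefl j), one_mul]
      refine Finset.prod_congr rfl fun i hi => ?_
      have hij := Finset.ne_of_mem_erase hi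
      rcases hij.lt_or_gt with h | h
      · rw [orderSign_of_gt h, if_pos h]
      · rw [orderSign_of_lt h, if_neg h.not_gt]
    rw [this, Finset.prod_ite, Finset.prod_const, Finset.prod_const_one, mul_one]
  have h4 : Even (S.filter fun i => i < j ∧ κ a ≠ κ i).card := by
    refine even_card_filter (κ := κ) (fun i hi h => ?_) ?_
    · have := hS (κ i)
      rwa [Finset.filter_insert, if_neg h.2] at this
    · rintro i hi l hl hil ⟨hij, hne⟩
      refine ⟨?_, hil ▸ hne⟩
      have hlj : l ≠ j := fun h => hne (by rw [hil, h, hj.2])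
      exact hlj.lt_or_gt.resolve_right fun h => hne (hκ (ha i hi) hij h hj.2 hil)
  rw [h3, ← Finset.card_filter_add_card_filter_not (s := S.filter fun i => i < j)
    (fun i => κ a = κ i), Finset.filter_filter, Finset.filter_filter, pow_add, h4.neg_one_pow,
    mul_one, hB, Finset.filter_filter]
  congr 3
  ext i
  exact and_comm

end Wick

/-! ### Spins -/

section Spins

variable {V : Type*}

theorem spin_eq_one_or (σ : Spins V) (v : V) : spin σ v = 1 ∨ spin σ v = -1 := by
  rcases Int.units_eq_one_or (σ v) with h | h <;> simp [spin, h]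

theorem spin_mul_self (σ : Spins V) (v : V) : spin σ v * spin σ v = 1 := by
  rcases spin_eq_one_or σ v with h | h <;> rw [h] <;> norm_num

theorem spin_mul (σ τ : Spins V) (v : V) : spin (σ * τ) v = spin σ v * spin τ v := by
  simp [spin]

theorem edgeSpin_mk (σ : Spins V) (u v : V) : edgeSpin σ s(u, v) = spin σ u * spin σ v := rfl

theorem edgeSpin_mul (σ τ : Spins V) (e : Sym2 V) :
    edgeSpin (σ * τ) e = edgeSpin σ e * edgeSpin τ e := by
  induction e with
  | h u v => simp only [edgeSpin_mk, spin_mul]; ring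

theorem edgeSpin_eq_one_or (σ : Spins V) (e : Sym2 V) : edgeSpin σ e = 1 ∨ edgeSpin σ e = -1 := by
  induction e with
  | h u v =>
    rw [edgeSpin_mk]
    rcases spin_eq_one_or σ u with h | h <;> rcases spin_eq_one_or σ v with h' | h' <;>
      rw [h, h'] <;> norm_num

variable {ι : Type*}

/-- The product of the spins at the nodes in `S`. -/
def spinProd (p : ι → V) (S : Finset ι) (σ : Spins V) : ℝ := ∏ i ∈ S, spin σ (p i)

theorem spinProd_mul (p : ι → V) (S : Finset ι) (σ τ : Spins V) :
    spinProd p S (σ * τ) = spinProd p S σ * spinProd p S τ := by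
  simp only [spinProd, spin_mul, Finset.prod_mul_distrib]

theorem spinProd_union [DecidableEq ι] (p : ι → V) {S R : Finset ι} (h : Disjoint S R)
    (σ : Spins V) : spinProd p (S ∪ R) σ = spinProd p S σ * spinProd p R σ := Finset.prod_union h

theorem spinProd_mul_self (p : ι → V) (S : Finset ι) (σ : Spins V) :
    spinProd p S σ * spinProd p S σ = 1 := by
  rw [spinProd, ← Finset.prod_mul_distrib]
  exact Finset.prod_eq_one fun i _ => spin_mul_self σ (p i)

theorem spin_eq_of_linked {H : Finset (Sym2 V)} {τ : Spins V} (hτ : ∀ e ∈ H, edgeSpin τ e = 1)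
    {u v : V} (h : Linked H u v) : spin τ v = spin τ u := by
  refine Linked.induct (Q := fun v => spin τ v = spin τ u) ?_ h rfl
  intro a b hab ha
  have h1 := hτ _ hab
  rw [edgeSpin_mk] at h1
  have h2 := spin_mul_self τ a
  rw [← ha]
  linear_combination (spin τ a) * h1 - (spin τ b) * h2

/-- The cluster of `v` in `H`. -/
def clusterSet (H : Finset (Sym2 V)) (v : V) : Set V := {w | Linked H v w}

theorem clusterSet_eq_iff {H : Finset (Sym2 V)} {u v : V} :
    clusterSet H u = clusterSet H v ↔ Linked H u v := by
  constructor
  · intro h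
    have : v ∈ clusterSet H v := Linked.refl H v
    rwa [← h] at this
  · intro h
    ext w
    exact ⟨h.symm.trans, h.trans⟩

open Classical in
/-- The spins `-1` on the cluster `C` of `H` and `1` elsewhere. -/
def flipSpins (H : Finset (Sym2 V)) (C : Set V) : Spins V :=
  fun v => if clusterSet H v = C then -1 else 1

open Classical in
theorem spin_flipSpins (H : Finset (Sym2 V)) (C : Set V) (v : V) :
    spin (flipSpins H C) v = if clusterSet H v = C then -1 else 1 := by
  simp only [spin, flipSpins]
  split_ifs <;> simp

theorem edgeSpin_flipSpins {H : Finset (Sym2 V)} (C : Set V) {e : Sym2 V} (he : e ∈ H) :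
    edgeSpin (flipSpins H C) e = 1 := by
  induction e with
  | h u v =>
    have : clusterSet H u = clusterSet H v :=
      clusterSet_eq_iff.mpr (Linked.of_mem he (by simp) (by simp))
    rw [edgeSpin_mk, spin_flipSpins, spin_flipSpins, this]
    split_ifs <;> norm_num

/-- The clusters of the nodes. -/
abbrev nodeCluster (p : ι → V) (H : Finset (Sym2 V)) (i : ι) : Set V := clusterSet H (p i)

open Classical in
theorem spinProd_flipSpins (p : ι → V) (H : Finset (Sym2 V)) (C : Set V) (S : Finset ι) :
    spinProd p S (flipSpins H C) = (-1) ^ (S.filter fun i => nodeCluster p H i = C).card := by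
  simp only [spinProd, spin_flipSpins]
  rw [Finset.prod_ite, Finset.prod_const, Finset.prod_const_one, mul_one]

end Spins

/-! ### Expansion of the doubled Ising model over sets of edges -/

section Expansion

variable {V : Type*} [Fintype V] [DecidableEq V] {ι : Type*}

theorem sum_eq_zero_of_flip {f : Spins V → ℝ} (τ : Spins V) (h : ∀ σ, f (τ * σ) = -f σ) :
    ∑ σ, f σ = 0 := by
  have h1 : ∑ σ, f (τ * σ) = ∑ σ, f σ := Equiv.sum_comp (Equiv.mulLeft τ) f
  simp only [h, Finset.sum_neg_distrib] at h1
  linarith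

/-- The weight of a set `H` of edges in the doubled model with sources at the nodes in `P`. -/
def sourceWeight (J : Sym2 V → ℝ) (p : ι → V) (H : Finset (Sym2 V)) (P : Finset ι) : ℝ :=
  ∑ σ : Spins V, spinProd p P σ *
    ∏ e ∈ H, ((Real.cosh (2 * J e) - 1) + Real.sinh (2 * J e) * edgeSpin σ e)

/-- The sum of a product of spins over all spins which are constant on the clusters of `H`. -/
def clusterSum (p : ι → V) (H : Finset (Sym2 V)) (R : Finset ι) : ℝ :=
  ∑ τ : Spins V, spinProd p R τ * ∏ e ∈ H, if edgeSpin τ e = 1 then 1 else 0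

open Classical in
theorem evenOn_of_sourceWeight_ne_zero {J : Sym2 V → ℝ} {p : ι → V} {H : Finset (Sym2 V)}
    {P : Finset ι} (h : sourceWeight J p H P ≠ 0) : EvenOn (nodeCluster p H) P := by
  intro C
  by_contra hC
  refine h (sum_eq_zero_of_flip (flipSpins H C) fun σ => ?_)
  rw [spinProd_mul, spinProd_flipSpins, (Nat.not_even_iff_odd.mp hC).neg_one_pow,
    Finset.prod_congr rfl fun e he => by rw [edgeSpin_mul, edgeSpin_flipSpins C he, one_mul]]
  ring

theorem clusterSum_empty_pos (p : ι → V) (H : Finset (Sym2 V)) : 0 < clusterSum p H ∅ := by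
  have hnn : ∀ τ : Spins V, 0 ≤ spinProd p ∅ τ * ∏ e ∈ H, if edgeSpin τ e = 1 then (1 : ℝ) else 0 :=
    fun τ => by
      rw [spinProd, Finset.prod_empty, one_mul]
      exact Finset.prod_nonneg fun e _ => by split_ifs <;> norm_num
  refine Finset.sum_pos' (fun τ _ => hnn τ) ⟨1, Finset.mem_univ _, ?_⟩
  rw [spinProd, Finset.prod_empty, one_mul]
  refine Finset.prod_pos fun e _ => ?_
  have : edgeSpin (1 : Spins V) e = 1 := by
    induction e with
    | h u v => simp [edgeSpin_mk, spin]
  rw [if_pos this]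
  exact one_pos

open Classical in
theorem clusterSum_eq (p : ι → V) (H : Finset (Sym2 V)) (R : Finset ι) :
    clusterSum p H R = if EvenOn (nodeCluster p H) R then clusterSum p H ∅ else 0 := by
  split_ifs with hR
  · refine Finset.sum_congr rfl fun τ _ => ?_
    by_cases hτ : ∀ e ∈ H, edgeSpin τ e = 1
    · congr 1
      rw [spinProd, spinProd, Finset.prod_empty,
        ← Finset.prod_fiberwise_of_maps_to (g := nodeCluster p H) (t := R.image (nodeCluster p H))
          fun i hi => Finset.mem_image_of_mem _ hi]
      refine Finset.prod_eq_one fun C hC => ?_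
      obtain ⟨i, hi, rfl⟩ := Finset.mem_image.mp hC
      rw [Finset.prod_congr rfl fun j hj => spin_eq_of_linked hτ
        (clusterSet_eq_iff.mp (Finset.mem_filter.mp hj).2.symm), Finset.prod_const]
      obtain ⟨m, hm⟩ := hR (nodeCluster p H i)
      rw [hm, pow_add, ← mul_pow, spin_mul_self, one_pow]
    · push Not at hτ
      obtain ⟨e, he, hne⟩ := hτ
      rw [Finset.prod_eq_zero he (if_neg hne), mul_zero, mul_zero]
  · unfold EvenOn at hR
    push Not at hR
    obtain ⟨C, hC⟩ := hR
    refine sum_eq_zero_of_flip (flipSpins H C) fun σ => ?_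
    rw [spinProd_mul, spinProd_flipSpins, (Nat.not_even_iff_odd.mp (by simpa using hC)).neg_one_pow,
      Finset.prod_congr rfl fun e he => by rw [edgeSpin_mul, edgeSpin_flipSpins C he, one_mul]]
    ring

theorem sum_character_nonneg {f : Spins V → ℝ} (hf : ∀ σ τ, f (σ * τ) = f σ * f τ)
    (hf1 : ∀ σ, f σ * f σ = 1) : 0 ≤ ∑ σ, f σ := by
  by_cases h : ∀ σ, f σ = 1
  · exact Finset.sum_nonneg fun σ _ => by rw [h σ]; exact zero_le_one
  · push Not at h
    obtain ⟨τ, hτ⟩ := h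
    have : f τ = -1 := (mul_self_eq_one_iff.mp (hf1 τ)).resolve_left hτ
    exact (sum_eq_zero_of_flip τ fun σ => by rw [hf, this, neg_one_mul]).ge

theorem sourceWeight_eq_sum (J : Sym2 V → ℝ) (p : ι → V) (H : Finset (Sym2 V)) (P : Finset ι) :
    sourceWeight J p H P = ∑ T ∈ H.powerset, (∏ e ∈ T, (Real.cosh (2 * J e) - 1)) *
      (∏ e ∈ H \ T, Real.sinh (2 * J e)) *
        ∑ σ : Spins V, spinProd p P σ * ∏ e ∈ H \ T, edgeSpin σ e := by
  simp only [sourceWeight, Finset.prod_add, Finset.mul_sum]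
  rw [Finset.sum_comm]
  refine Finset.sum_congr rfl fun T _ => Finset.sum_congr rfl fun σ _ => ?_
  rw [Finset.prod_mul_distrib]
  ring

theorem sourceWeight_term_nonneg {J : Sym2 V → ℝ} (p : ι → V) {H : Finset (Sym2 V)}
    (hJ : ∀ e ∈ H, 0 ≤ J e) (P : Finset ι) (T : Finset (Sym2 V)) :
    0 ≤ (∏ e ∈ T, (Real.cosh (2 * J e) - 1)) * (∏ e ∈ H \ T, Real.sinh (2 * J e)) *
        ∑ σ : Spins V, spinProd p P σ * ∏ e ∈ H \ T, edgeSpin σ e := by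
  refine mul_nonneg (mul_nonneg ?_ ?_) ?_
  · exact Finset.prod_nonneg fun e _ => sub_nonneg.mpr (Real.one_le_cosh _)
  · exact Finset.prod_nonneg fun e he =>
      Real.sinh_nonneg_iff.mpr (by have := hJ e (Finset.sdiff_subset he); linarith)
  · refine sum_character_nonneg (fun σ τ => ?_) fun σ => ?_
    · simp only [spinProd_mul, edgeSpin_mul, Finset.prod_mul_distrib]; ring
    · rw [mul_mul_mul_comm, spinProd_mul_self, ← Finset.prod_mul_distrib, one_mul]
      refine Finset.prod_eq_one fun e _ => ?_
      rcases edgeSpin_eq_one_or σ e with h | h <;> rw [h] <;> norm_num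

theorem sourceWeight_nonneg {J : Sym2 V → ℝ} (p : ι → V) {H : Finset (Sym2 V)}
    (hJ : ∀ e ∈ H, 0 ≤ J e) (P : Finset ι) : 0 ≤ sourceWeight J p H P := by
  rw [sourceWeight_eq_sum]
  exact Finset.sum_nonneg fun T _ => sourceWeight_term_nonneg p hJ P T

theorem sourceWeight_pos {J : Sym2 V → ℝ} {p : ι → V} {H : Finset (Sym2 V)}
    (hJ : ∀ e ∈ H, 0 < J e) {P : Finset ι}
    (hP : ∀ σ : Spins V, spinProd p P σ * ∏ e ∈ H, edgeSpin σ e = 1) :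
    0 < sourceWeight J p H P := by
  rw [sourceWeight_eq_sum]
  refine Finset.sum_pos' (fun T _ => sourceWeight_term_nonneg p (fun e he => (hJ e he).le) P T) ⟨∅, Finset.empty_mem_powerset H, ?_⟩
  rw [Finset.prod_empty, one_mul, Finset.sdiff_empty]
  simp only [hP]
  refine mul_pos (Finset.prod_pos fun e he => Real.sinh_pos_iff.mpr ?_) ?_
  · have := hJ e he; linarith
  · exact Finset.sum_pos (fun _ _ => one_pos) ⟨1, Finset.mem_univ _⟩

theorem pos_of_sourceWeight_ne_zero {J : Sym2 V → ℝ} {p : ι → V} {H : Finset (Sym2 V)}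
    {P : Finset ι} (hJ : ∀ e ∈ H, 0 ≤ J e) (h : sourceWeight J p H P ≠ 0) {e : Sym2 V}
    (he : e ∈ H) : 0 < J e := by
  refine lt_of_le_of_ne (hJ e he) fun h0 => h ?_
  refine Finset.sum_eq_zero fun σ _ => ?_
  rw [Finset.prod_eq_zero he (by rw [← h0]; simp), mul_zero]

theorem exp_mul_exp_edge (J x y : ℝ) (hx : x = 1 ∨ x = -1) (hy : y = 1 ∨ y = -1) :
    Real.exp (J * x) * Real.exp (J * (x * y))
      = 1 + ((Real.cosh (2 * J) - 1) + Real.sinh (2 * J) * x) * if y = 1 then 1 else 0 := by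
  rw [← Real.exp_add]
  rcases hy with rfl | rfl
  · rw [if_pos rfl]
    rcases hx with rfl | rfl
    · rw [show J * 1 + J * (1 * 1) = 2 * J by ring, ← Real.cosh_add_sinh]; ring
    · rw [show J * -1 + J * (-1 * 1) = -(2 * J) by ring, ← Real.cosh_sub_sinh]; ring
  · rw [if_neg (by norm_num), show J * x + J * (x * -1) = 0 by ring, Real.exp_zero]; ring

variable (G : SimpleGraph V) [DecidableRel G.Adj] (J : Sym2 V → ℝ)

/-- The weight of one copy of the Ising model. -/
def isingWeight (σ : Spins V) : ℝ := ∏ e ∈ G.edgeFinset, Real.exp (J e * edgeSpin σ e)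

/-- The partition function of one copy of the Ising model. -/
def isingZ : ℝ := ∑ σ : Spins V, isingWeight G J σ

theorem isingZ_pos : 0 < isingZ G J :=
  Finset.sum_pos (fun _ _ => Finset.prod_pos fun _ _ => Real.exp_pos _) ⟨1, Finset.mem_univ _⟩

/-- The correlation of the spins at the nodes in `S`. -/
def correlation (p : ι → V) (S : Finset ι) : ℝ :=
  (∑ σ : Spins V, spinProd p S σ * isingWeight G J σ) / isingZ G J

theorem correlation_empty (p : ι → V) : correlation G J p ∅ = 1 := by
  simp only [correlation, spinProd, Finset.prod_empty, one_mul]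
  exact div_self (isingZ_pos G J).ne'

variable [LinearOrder ι]

/-- The product of two correlations as a sum over sets of edges with sources at all nodes. -/
theorem correlation_mul_correlation (p : ι → V) {S R : Finset ι} (hSR : Disjoint S R) :
    isingZ G J ^ 2 * (correlation G J p S * correlation G J p R)
      = ∑ H ∈ G.edgeFinset.powerset, sourceWeight J p H (S ∪ R) * clusterSum p H R := by
  have hZ := (isingZ_pos G J).ne'
  have h1 : isingZ G J ^ 2 * (correlation G J p S * correlation G J p R)
      = (∑ σ, spinProd p S σ * isingWeight G J σ) * ∑ σ, spinProd p R σ * isingWeight G J σ := by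
    rw [correlation, correlation]; field_simp
  rw [h1, Fintype.sum_mul_sum]
  have h2 : ∀ σ : Spins V, ∑ σ' : Spins V, spinProd p S σ * isingWeight G J σ *
      (spinProd p R σ' * isingWeight G J σ')
      = ∑ τ : Spins V, ∑ H ∈ G.edgeFinset.powerset, (spinProd p (S ∪ R) σ *
        ∏ e ∈ H, ((Real.cosh (2 * J e) - 1) + Real.sinh (2 * J e) * edgeSpin σ e)) *
        (spinProd p R τ * ∏ e ∈ H, if edgeSpin τ e = 1 then 1 else 0) := by
    intro σ
    rw [← Equiv.sum_comp (Equiv.mulLeft σ)]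
    refine Finset.sum_congr rfl fun τ _ => ?_
    have h3 : isingWeight G J σ * isingWeight G J (σ * τ) = ∑ H ∈ G.edgeFinset.powerset,
        ∏ e ∈ H, (((Real.cosh (2 * J e) - 1) + Real.sinh (2 * J e) * edgeSpin σ e) *
          if edgeSpin τ e = 1 then 1 else 0) := by
      rw [← Finset.prod_one_add, isingWeight, isingWeight, ← Finset.prod_mul_distrib]
      refine Finset.prod_congr rfl fun e _ => ?_
      rw [edgeSpin_mul]
      exact exp_mul_exp_edge _ _ _ (edgeSpin_eq_one_or σ e) (edgeSpin_eq_one_or τ e)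
    rw [Equiv.coe_mulLeft, spinProd_mul, spinProd_union p hSR,
      show spinProd p S σ * isingWeight G J σ *
        (spinProd p R σ * spinProd p R τ * isingWeight G J (σ * τ))
        = spinProd p S σ * spinProd p R σ * spinProd p R τ *
          (isingWeight G J σ * isingWeight G J (σ * τ)) by ring, h3, Finset.mul_sum]
    refine Finset.sum_congr rfl fun H _ => ?_
    rw [Finset.prod_mul_distrib]
    ring
  simp only [h2]
  rw [Finset.sum_congr rfl fun σ _ => Finset.sum_comm, Finset.sum_comm]
  refine Finset.sum_congr rfl fun H _ => ?_
  rw [sourceWeight, clusterSum, Fintype.sum_mul_sum]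

/-- The correlations as complex numbers. -/
def complexCorrelation (p : ι → V) (S : Finset ι) : ℂ := (correlation G J p S : ℂ)

theorem complexCorrelation_mul (p : ι → V) {S R : Finset ι} (hSR : Disjoint S R) :
    (isingZ G J : ℂ) ^ 2 * (complexCorrelation G J p S * complexCorrelation G J p R)
      = ∑ H ∈ G.edgeFinset.powerset, (sourceWeight J p H (S ∪ R) : ℂ) * clusterSum p H R := by
  have := congrArg (fun r : ℝ => (r : ℂ)) (correlation_mul_correlation G J p hSR)
  push_cast at this
  exact this

/-- Correlations at the nodes around the outer face of a plane graph satisfy Wick's rule. -/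
theorem isWick_complexCorrelation {p : ι → V}
    (hNC : ∀ H ⊆ G.edgeFinset, NonCrossing (nodeCluster p H)) :
    IsWick (complexCorrelation G J p) := by
  classical
  intro a S ha
  have haS : a ∉ S := fun h => (ha a h).false
  have hZ : (isingZ G J : ℂ) ^ 2 ≠ 0 :=
    pow_ne_zero _ (Complex.ofReal_ne_zero.mpr (isingZ_pos G J).ne')
  refine mul_left_cancel₀ hZ ?_
  have h0 := complexCorrelation_mul G J p (Finset.disjoint_empty_right (insert a S))
  have hone : complexCorrelation G J p ∅ = 1 := by
    rw [complexCorrelation, correlation_empty, Complex.ofReal_one]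
  rw [hone, mul_one, Finset.union_empty] at h0
  rw [h0, Finset.mul_sum]
  have h1 : ∀ j ∈ S, (isingZ G J : ℂ) ^ 2 * (frontSign j (S.erase j) *
      complexCorrelation G J p {a, j} * complexCorrelation G J p (S.erase j))
      = ∑ H ∈ G.edgeFinset.powerset, (sourceWeight J p H (insert a S) : ℂ) * clusterSum p H ∅ *
        (frontSign j (S.erase j) * if nodeCluster p H a = nodeCluster p H j then 1 else 0) := by
    intro j hj
    have haj : a ≠ j := fun h => haS (h ▸ hj)
    have hd : Disjoint (S.erase j) {a, j} := by
      simp only [Finset.disjoint_right, Finset.mem_insert, Finset.mem_singleton, Finset.mem_erase]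
      rintro i (rfl | rfl) <;> tauto
    have hu : S.erase j ∪ {a, j} = insert a S := by
      rw [Finset.union_insert, Finset.union_comm, ← Finset.insert_eq, Finset.insert_erase hj]
    have h2 := complexCorrelation_mul G J p hd
    rw [hu] at h2
    calc _ = frontSign j (S.erase j) * ((isingZ G J : ℂ) ^ 2 *
          (complexCorrelation G J p (S.erase j) * complexCorrelation G J p {a, j})) := by ring
      _ = _ := by
        rw [h2, Finset.mul_sum]
        refine Finset.sum_congr rfl fun H _ => ?_
        rw [clusterSum_eq, evenOn_pair_iff haj]
        split_ifs
        · ring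
        · simp
  rw [Finset.sum_congr rfl h1, Finset.sum_comm]
  refine Finset.sum_congr rfl fun H hH => ?_
  rw [← Finset.mul_sum]
  by_cases hs : sourceWeight J p H (insert a S) = 0
  · rw [hs]; simp
  · rw [sum_frontSign_of_nonCrossing (hNC H (Finset.mem_powerset.mp hH)) ha
      (evenOn_of_sourceWeight_ne_zero hs), mul_one]

open Classical in
theorem splitSum_complexCorrelation (p : ι → V) (η : ι → ℂ) (P : Finset ι) :
    (isingZ G J : ℂ) ^ 2 * splitSum (complexCorrelation G J p) η P
      = ∑ H ∈ G.edgeFinset.powerset, (sourceWeight J p H P : ℂ) * clusterSum p H ∅ *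
        signedSplits (nodeCluster p H) η P := by
  rw [splitSum, Finset.mul_sum]
  simp only [signedSplits, Finset.mul_sum]
  rw [Finset.sum_comm]
  refine Finset.sum_congr rfl fun S hS => ?_
  have h2 := complexCorrelation_mul G J p (Finset.disjoint_sdiff (s := S) (t := P))
  rw [Finset.union_sdiff_of_subset (Finset.mem_powerset.mp hS)] at h2
  rw [mul_left_comm, h2, Finset.mul_sum]
  refine Finset.sum_congr rfl fun H _ => ?_
  rw [clusterSum_eq]
  split_ifs
  · ring
  · simp

set_option linter.unusedSectionVars false in
theorem weight_zero (σ σ' : Spins V) :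
    weight G J 0 σ σ' = isingWeight G J σ * isingWeight G J σ' := by
  rw [weight, isingWeight, isingWeight, ← Finset.prod_mul_distrib]
  refine Finset.prod_congr rfl fun e _ => ?_
  rw [← Real.exp_add]
  congr 1
  simp only [Pi.zero_apply]
  ring

theorem expectation_zero (f : Spins V → ℝ) :
    expectation G J 0 (fun σ _ => f σ) = (∑ σ, f σ * isingWeight G J σ) / isingZ G J := by
  have hZ := (isingZ_pos G J).ne'
  have hpart : partitionFunction G J 0 = isingZ G J * isingZ G J := by
    simp only [partitionFunction, weight_zero, isingZ, Fintype.sum_mul_sum]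
  simp only [expectation, prob, hpart, weight_zero]
  rw [Finset.sum_div]
  refine Finset.sum_congr rfl fun σ _ => ?_
  have : ∀ σ' : Spins V, f σ * (isingWeight G J σ * isingWeight G J σ' / (isingZ G J * isingZ G J))
      = (f σ * isingWeight G J σ / (isingZ G J * isingZ G J)) * isingWeight G J σ' :=
    fun σ' => by ring
  rw [Finset.sum_congr rfl fun σ' _ => this σ', ← Finset.mul_sum]
  change _ * isingZ G J = _
  field_simp

end Expansion

/-! ### Minors of the two-point matrix -/

section Minors

variable {n : ℕ}

/-- The type of a node in the sequence `s_1, …, s_n, t_n, …, t_1`. -/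
def nodeType (i : Fin (n + n)) : ℂ := if (i : ℕ) < n then Complex.I else -Complex.I

/-- The place of `s_i` in the sequence `s_1, …, s_n, t_n, …, t_1`. -/
def sourceNode (i : Fin n) : Fin (n + n) := Fin.castAdd n i

/-- The place of `t_j` in the sequence `s_1, …, s_n, t_n, …, t_1`. -/
def targetNode (j : Fin n) : Fin (n + n) := Fin.natAdd n j.rev

theorem sourceNode_strictMono : StrictMono (sourceNode (n := n)) := Fin.strictMono_castAdd n

theorem targetNode_strictAnti : StrictAnti (targetNode (n := n)) := fun _ _ h =>
  Fin.strictMono_natAdd n (Fin.rev_lt_rev.mpr h)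

theorem sourceNode_lt_targetNode (i j : Fin n) : sourceNode i < targetNode j := by
  rw [Fin.lt_def, sourceNode, targetNode, Fin.val_castAdd, Fin.val_natAdd]
  omega

theorem nodeType_sourceNode (i : Fin n) : nodeType (sourceNode i) = Complex.I :=
  if_pos (by simp [sourceNode])

theorem nodeType_targetNode (j : Fin n) : nodeType (targetNode j) = -Complex.I :=
  if_neg (by simp [targetNode])

theorem nodeType_mul_self (i : Fin (n + n)) : nodeType i * nodeType i = -1 := by
  unfold nodeType
  split_ifs <;> simp

theorem I_ne_neg_I : Complex.I ≠ -Complex.I := by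
  intro h
  have := congrArg Complex.im h
  norm_num at this

theorem nodeType_convex (a b c : Fin (n + n)) (hab : a < b) (hbc : b < c)
    (h : nodeType a = nodeType c) : nodeType b = nodeType a := by
  rw [Fin.lt_def] at hab hbc
  unfold nodeType at h ⊢
  by_cases hc : (c : ℕ) < n
  · rw [if_pos (by omega), if_pos (by omega)]
  · rw [if_neg hc] at h
    have ha : ¬ (a : ℕ) < n := fun ha => I_ne_neg_I (by rwa [if_pos ha] at h)
    rw [if_neg (by omega), if_neg ha]

theorem nodeType_mul_of_ne {a b : Fin (n + n)} (h : nodeType a ≠ nodeType b) :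
    nodeType a * nodeType b = 1 := by
  unfold nodeType at h ⊢
  split_ifs at h ⊢ <;> simp_all

variable {V : Type*}

theorem parallelSeq_sourceNode (s t : Fin n → V) (i : Fin n) :
    parallelSeq s t (sourceNode i) = s i := Fin.append_left _ _ _

theorem parallelSeq_targetNode (s t : Fin n → V) (j : Fin n) :
    parallelSeq s t (targetNode j) = t j := by
  rw [parallelSeq, targetNode, Fin.append_right, Fin.rev_rev]

/-- The nodes `s_i`, `i ∈ I`, and `t_j`, `j ∈ I'`. -/
def nodes (I I' : Finset (Fin n)) : Finset (Fin (n + n)) :=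
  I.image sourceNode ∪ I'.image targetNode

theorem nodeCluster_nonCrossing {G : SimpleGraph V} {D : PlaneEmbedding G} {m : ℕ}
    {p : Fin m → V} (hp : D.IsOuterOrder p) {H : Finset (Sym2 V)} (hH : ∀ e ∈ H, e ∈ G.edgeSet) :
    NonCrossing (nodeCluster p H) := fun _ _ _ _ hab hbc hcd hac hbd =>
  clusterSet_eq_iff.mpr (hp.linked_of_interlaced hH hab hbc hcd (clusterSet_eq_iff.mp hac)
    (clusterSet_eq_iff.mp hbd))

/-- No two nodes of the same type in `P` lie in one cluster of `H`. -/
def TypesSeparated (p : Fin (n + n) → V) (H : Finset (Sym2 V)) (P : Finset (Fin (n + n))) : Prop :=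
  ∀ a ∈ P, ∀ b ∈ P, Linked H (p a) (p b) → nodeType a = nodeType b → a = b

open Classical in
theorem exists_signedSplits_nodeCluster {p : Fin (n + n) → V} {H : Finset (Sym2 V)}
    (hNC : NonCrossing (nodeCluster p H)) {P : Finset (Fin (n + n))}
    (hP : EvenOn (nodeCluster p H) P) :
    ∃ m : ℕ, signedSplits (nodeCluster p H) nodeType P = m ∧ (0 < m ↔ TypesSeparated p H P) := by
  by_cases hsep : TypesSeparated p H P
  · obtain ⟨m, hm, he⟩ := exists_signedSplits_eq_natCast hNC hP (η := nodeType)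
      (fun a ha b hb hab hne => nodeType_mul_of_ne fun h =>
        hne (hsep a ha b hb (clusterSet_eq_iff.mp hab) h)) nodeType_mul_self
    exact ⟨m, he, by simp [hm, hsep]⟩
  · refine ⟨0, ?_, by simp [hsep]⟩
    unfold TypesSeparated at hsep
    push Not at hsep
    obtain ⟨a, ha, b, hb, hab, ht, hne⟩ := hsep
    rw [Nat.cast_zero]
    rcases hne.lt_or_gt with h | h
    · exact signedSplits_eq_zero hNC nodeType_mul_self nodeType_convex hP ha hb h
        (clusterSet_eq_iff.mpr hab) ht
    · exact signedSplits_eq_zero hNC nodeType_mul_self nodeType_convex hP hb ha h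
        (clusterSet_eq_iff.mpr hab.symm) ht.symm

variable [Fintype V] [DecidableEq V] (G : SimpleGraph V) [DecidableRel G.Adj] (J : Sym2 V → ℝ)

theorem twoPointMatrix_eq_correlation (s t : Fin n → V) (i j : Fin n) :
    twoPointMatrix G J 0 s t i j
      = correlation G J (parallelSeq s t) {sourceNode i, targetNode j} := by
  rw [twoPointMatrix, expectation_zero G J fun σ => spin σ (s i) * spin σ (t j), correlation]
  congr 1
  refine Finset.sum_congr rfl fun σ _ => ?_
  rw [spinProd, Finset.prod_pair (sourceNode_lt_targetNode i j).ne, parallelSeq_sourceNode,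
    parallelSeq_targetNode]

/-- A minor as a sum of nonnegative terms over sets of edges. -/
theorem exists_minor_eq_sum {D : PlaneEmbedding G} {s t : Fin n → V}
    (hst : D.IsOuterOrder (parallelSeq s t)) {k : ℕ} (I I' : Finset (Fin n)) (hI : I.card = k)
    (hI' : I'.card = k) :
    ∃ m : Finset (Sym2 V) → ℕ,
      (∀ H ⊆ G.edgeFinset, sourceWeight J (parallelSeq s t) H (nodes I I') ≠ 0 →
        (0 < m H ↔ TypesSeparated (parallelSeq s t) H (nodes I I'))) ∧
      2 ^ k * isingZ G J ^ 2 * minor (twoPointMatrix G J 0 s t) I I' hI hI'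
        = ∑ H ∈ G.edgeFinset.powerset, sourceWeight J (parallelSeq s t) H (nodes I I') *
            clusterSum (parallelSeq s t) H ∅ * m H := by
  classical
  set p := parallelSeq s t with hp
  have hNC : ∀ H ⊆ G.edgeFinset, NonCrossing (nodeCluster p H) := fun H hH =>
    nodeCluster_nonCrossing hst fun e he => SimpleGraph.mem_edgeFinset.mp (hH he)
  have hex : ∀ H : Finset (Sym2 V), ∃ m : ℕ, H ⊆ G.edgeFinset →
      sourceWeight J p H (nodes I I') ≠ 0 →
      signedSplits (nodeCluster p H) nodeType (nodes I I') = m ∧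
        (0 < m ↔ TypesSeparated p H (nodes I I')) := by
    intro H
    by_cases h : H ⊆ G.edgeFinset ∧ sourceWeight J p H (nodes I I') ≠ 0
    · obtain ⟨m, hm⟩ := exists_signedSplits_nodeCluster (hNC H h.1)
        (evenOn_of_sourceWeight_ne_zero h.2)
      exact ⟨m, fun _ _ => hm⟩
    · exact ⟨0, fun h1 h2 => absurd ⟨h1, h2⟩ h⟩
  choose m hm using hex
  refine ⟨m, fun H hH hs => (hm H hH hs).2, ?_⟩
  set x : Fin k → Fin (n + n) := fun i => sourceNode (I.orderEmbOfFin hI i) with hx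
  set y : Fin k → Fin (n + n) := fun j => targetNode (I'.orderEmbOfFin hI' j) with hy
  have hnodes : nodes I I' = Finset.univ.image x ∪ Finset.univ.image y := by
    have himage : ∀ (K : Finset (Fin n)) (hK : K.card = k) (f : Fin n → Fin (n + n)),
        K.image f = Finset.univ.image fun i => f (K.orderEmbOfFin hK i) := by
      intro K hK f
      conv_lhs => rw [← Finset.image_orderEmbOfFin_univ K hK]
      rw [Finset.image_image]
      rfl
    rw [nodes, himage I hI, himage I' hI']
  have hone : complexCorrelation G J p ∅ = 1 := by
    rw [complexCorrelation, correlation_empty, Complex.ofReal_one]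
  have hdet := (isWick_complexCorrelation G J hNC).splitSum_eq_det hone (η := nodeType) (x := x)
    (y := y) (sourceNode_strictMono.comp (I.orderEmbOfFin hI).strictMono)
    (targetNode_strictAnti.comp_strictMono (I'.orderEmbOfFin hI').strictMono)
    (fun _ _ => sourceNode_lt_targetNode _ _) (fun _ => nodeType_sourceNode _)
    (fun _ => nodeType_targetNode _)
  have hminor : (Matrix.of fun i j => complexCorrelation G J p {x i, y j}).det
      = ((minor (twoPointMatrix G J 0 s t) I I' hI hI' : ℝ) : ℂ) := by
    rw [minor, ← Complex.ofRealHom_eq_coe, RingHom.map_det]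
    congr 1
    ext i j
    simp only [Matrix.of_apply, RingHom.mapMatrix_apply, Matrix.map_apply, Matrix.submatrix_apply,
      twoPointMatrix_eq_correlation]
    rfl
  rw [← hnodes, hminor] at hdet
  have hsum := splitSum_complexCorrelation G J p nodeType (nodes I I')
  rw [hdet] at hsum
  have : ∑ H ∈ G.edgeFinset.powerset, (sourceWeight J p H (nodes I I') : ℂ) * clusterSum p H ∅ *
        signedSplits (nodeCluster p H) nodeType (nodes I I')
      = ∑ H ∈ G.edgeFinset.powerset, (sourceWeight J p H (nodes I I') : ℂ) * clusterSum p H ∅ *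
        (m H : ℂ) := by
    refine Finset.sum_congr rfl fun H hH => ?_
    by_cases hs : sourceWeight J p H (nodes I I') = 0
    · rw [hs]; simp
    · rw [(hm H (Finset.mem_powerset.mp hH) hs).1]
  rw [this] at hsum
  have hcast : ((2 ^ k * isingZ G J ^ 2 * minor (twoPointMatrix G J 0 s t) I I' hI hI' : ℝ) : ℂ)
      = ((∑ H ∈ G.edgeFinset.powerset, sourceWeight J p H (nodes I I') * clusterSum p H ∅ *
        (m H : ℝ) : ℝ) : ℂ) := by
    push_cast
    rw [← hsum]
    ring
  exact Complex.ofReal_injective hcast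

variable {G J}

theorem minor_nonneg (hJ : ∀ e ∈ G.edgeSet, 0 ≤ J e) {D : PlaneEmbedding G} {s t : Fin n → V}
    (hst : D.IsOuterOrder (parallelSeq s t)) {k : ℕ} (I I' : Finset (Fin n)) (hI : I.card = k)
    (hI' : I'.card = k) : 0 ≤ minor (twoPointMatrix G J 0 s t) I I' hI hI' := by
  obtain ⟨m, -, h⟩ := exists_minor_eq_sum G J hst I I' hI hI'
  have hZ := isingZ_pos G J
  refine nonneg_of_mul_nonneg_right (a := 2 ^ k * isingZ G J ^ 2) ?_ (by positivity)
  rw [h]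
  refine Finset.sum_nonneg fun H hH => mul_nonneg (mul_nonneg ?_ (clusterSum_empty_pos _ H).le)
    (Nat.cast_nonneg _)
  exact sourceWeight_nonneg _ (fun e he => hJ e (SimpleGraph.mem_edgeFinset.mp
    (Finset.mem_powerset.mp hH he))) _

theorem minor_pos_iff (hJ : ∀ e ∈ G.edgeSet, 0 ≤ J e) {D : PlaneEmbedding G} {s t : Fin n → V}
    (hst : D.IsOuterOrder (parallelSeq s t)) {k : ℕ} (I I' : Finset (Fin n)) (hI : I.card = k)
    (hI' : I'.card = k) :
    0 < minor (twoPointMatrix G J 0 s t) I I' hI hI' ↔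
      ∃ H ⊆ G.edgeFinset, sourceWeight J (parallelSeq s t) H (nodes I I') ≠ 0 ∧
        TypesSeparated (parallelSeq s t) H (nodes I I') := by
  obtain ⟨m, hm, h⟩ := exists_minor_eq_sum G J hst I I' hI hI'
  have hZ := isingZ_pos G J
  have hpos : (0 : ℝ) < 2 ^ k * isingZ G J ^ 2 := by positivity
  have hnn : ∀ H ∈ G.edgeFinset.powerset, 0 ≤ sourceWeight J (parallelSeq s t) H (nodes I I') :=
    fun H hH => sourceWeight_nonneg _ (fun e he => hJ e (SimpleGraph.mem_edgeFinset.mp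
      (Finset.mem_powerset.mp hH he))) _
  rw [← mul_pos_iff_of_pos_left hpos, h, Finset.sum_pos_iff_of_nonneg fun H hH =>
    mul_nonneg (mul_nonneg (hnn H hH) (clusterSum_empty_pos _ H).le) (Nat.cast_nonneg _)]
  constructor
  · rintro ⟨H, hH, hlt⟩
    have hsub := Finset.mem_powerset.mp hH
    have hs : sourceWeight J (parallelSeq s t) H (nodes I I') ≠ 0 := by
      intro h0; rw [h0] at hlt; simp at hlt
    have hm0 : m H ≠ 0 := by
      intro h0; rw [h0] at hlt; simp at hlt
    exact ⟨H, hsub, hs, (hm H hsub hs).mp (Nat.pos_of_ne_zero hm0)⟩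
  · rintro ⟨H, hH, hs, hsep⟩
    have hH' := Finset.mem_powerset.mpr hH
    refine ⟨H, hH', mul_pos (mul_pos (lt_of_le_of_ne (hnn H hH') hs.symm)
      (clusterSum_empty_pos _ H)) ?_⟩
    exact_mod_cast (hm H hH hs).mpr hsep

end Minors

/-! ### Disjoint paths -/

section Paths

variable {V : Type*} {n : ℕ}

theorem positiveSubgraph_adj {G : SimpleGraph V} {J : Sym2 V → ℝ} {u v : V} :
    (positiveSubgraph G J).Adj u v ↔ G.Adj u v ∧ 0 < J s(u, v) := by
  rw [positiveSubgraph, SimpleGraph.fromEdgeSet_adj]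
  simp only [Set.mem_ofPred_eq, SimpleGraph.mem_edgeSet]
  exact ⟨fun h => h.1, fun h => ⟨h, h.1.ne⟩⟩

theorem positiveSubgraph_eq {G : SimpleGraph V} {J : Sym2 V → ℝ}
    (hJ : ∀ e ∈ G.edgeSet, 0 < J e) : positiveSubgraph G J = G := by
  ext u v
  rw [positiveSubgraph_adj]
  exact ⟨fun h => h.1, fun h => ⟨h, hJ _ h⟩⟩

theorem sourceNode_mem_nodes {I I' : Finset (Fin n)} {i : Fin n} (hi : i ∈ I) :
    sourceNode i ∈ nodes I I' :=
  Finset.mem_union_left _ (Finset.mem_image_of_mem _ hi)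

theorem mem_nodes_iff {I I' : Finset (Fin n)} {a : Fin (n + n)} :
    a ∈ nodes I I' ↔ (∃ i ∈ I, sourceNode i = a) ∨ ∃ j ∈ I', targetNode j = a := by
  simp only [nodes, Finset.mem_union, Finset.mem_image]

theorem linked_of_mem_support {H : Finset (Sym2 V)} {u v w : V}
    (q : (SimpleGraph.fromEdgeSet (H : Set (Sym2 V))).Walk u v) (hw : w ∈ q.support) :
    Linked H u w := by
  classical
  exact ⟨q.takeUntil w hw⟩

open Classical in
/-- If each cluster that contains a node contains one of each type, then the clusters contain
disjoint paths between the nodes. -/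
theorem hasDisjointPaths_of_typesSeparated {K : SimpleGraph V} {H : Finset (Sym2 V)}
    (hH : ∀ e ∈ H, e ∈ K.edgeSet) {s t : Fin n → V} {I I' : Finset (Fin n)}
    (hcard : I.card = I'.card) (heven : EvenOn (nodeCluster (parallelSeq s t) H) (nodes I I'))
    (hsep : TypesSeparated (parallelSeq s t) H (nodes I I')) : HasDisjointPaths K s t I I' := by
  have hsource : ∀ i ∈ I, ∀ i' ∈ I, Linked H (s i) (s i') → i = i' := by
    intro i hi i' hi' h
    refine sourceNode_strictMono.injective (hsep _ (sourceNode_mem_nodes hi) _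
      (sourceNode_mem_nodes hi') ?_ ?_)
    · rwa [parallelSeq_sourceNode, parallelSeq_sourceNode]
    · rw [nodeType_sourceNode, nodeType_sourceNode]
  have hex : ∀ i : I, ∃ j : I', Linked H (s i) (t j) := by
    rintro ⟨i, hi⟩
    set C := (nodes I I').filter fun a =>
      nodeCluster (parallelSeq s t) H a = nodeCluster (parallelSeq s t) H (sourceNode i) with hC
    have hmem : sourceNode i ∈ C := by simp [hC, sourceNode_mem_nodes hi]
    have hne : (C.erase (sourceNode i)).Nonempty := by
      rw [← Finset.card_pos, Finset.card_erase_of_mem hmem]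
      have h0 : 0 < C.card := Finset.card_pos.mpr ⟨_, hmem⟩
      obtain ⟨c, hc⟩ := heven (nodeCluster (parallelSeq s t) H (sourceNode i))
      rw [← hC] at hc
      omega
    obtain ⟨b, hb⟩ := hne
    rw [Finset.mem_erase, hC, Finset.mem_filter, clusterSet_eq_iff, parallelSeq_sourceNode] at hb
    obtain ⟨hbi, hbP, hlink⟩ := hb
    rcases mem_nodes_iff.mp hbP with ⟨i', hi', rfl⟩ | ⟨j, hj, rfl⟩
    · rw [parallelSeq_sourceNode] at hlink
      exact absurd (congrArg sourceNode (hsource i hi i' hi' hlink.symm)).symm hbi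
    · rw [parallelSeq_targetNode] at hlink
      exact ⟨⟨j, hj⟩, hlink.symm⟩
  choose e he using hex
  have hinj : Function.Injective e := by
    intro i i' h
    exact Subtype.ext (hsource i i.2 i' i'.2 ((he i).trans (h ▸ (he i').symm)))
  have hbij : Function.Bijective e := by
    rw [Fintype.bijective_iff_injective_and_card]
    exact ⟨hinj, by simpa using hcard⟩
  have hle : SimpleGraph.fromEdgeSet (H : Set (Sym2 V)) ≤ K := by
    intro u v h
    rw [SimpleGraph.fromEdgeSet_adj] at h
    exact hH _ h.1
  have hpath : ∀ i : I, ∃ q : (SimpleGraph.fromEdgeSet (H : Set (Sym2 V))).Walk (s i) (t (e i)),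
      q.IsPath := fun i => (he i).exists_isPath
  choose q hq using hpath
  refine ⟨Equiv.ofBijective e hbij, fun i => ⟨(q i).mapLe hle, (hq i).mapLe hle⟩, ?_⟩
  intro i j hij v hvi hvj
  change v ∈ ((q i).mapLe hle).support at hvi
  change v ∈ ((q j).mapLe hle).support at hvj
  rw [SimpleGraph.Walk.support_mapLe_eq_support] at hvi hvj
  exact hij (Subtype.ext (hsource i i.2 j j.2
    ((linked_of_mem_support _ hvi).trans (linked_of_mem_support _ hvj).symm)))

theorem prod_edgeSpin_edges {K : SimpleGraph V} (σ : Spins V) {u v : V} (q : K.Walk u v) :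
    (q.edges.map (edgeSpin σ)).prod = spin σ u * spin σ v := by
  induction q with
  | nil => simp [spin_mul_self]
  | @cons a b c _ _ ih =>
    rw [SimpleGraph.Walk.edges_cons, List.map_cons, List.prod_cons, ih, edgeSpin_mk]
    linear_combination (spin σ a * spin σ c) * spin_mul_self σ b

variable [DecidableEq V]

/-- The edges of a family of paths. -/
def pathEdges {K : SimpleGraph V} {s t : Fin n → V} {I I' : Finset (Fin n)} {e : I ≃ I'}
    (p : ∀ i : I, K.Path (s i) (t (e i))) : Finset (Sym2 V) :=
  Finset.univ.biUnion fun i => (p i).1.edges.toFinset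

variable {K : SimpleGraph V} {s t : Fin n → V} {I I' : Finset (Fin n)} {e : I ≃ I'}
  {p : ∀ i : I, K.Path (s i) (t (e i))}

theorem mem_support_of_linked_pathEdges
    (hp : ∀ i j : I, i ≠ j → List.Disjoint (p i).1.support (p j).1.support) {u v : V}
    (h : Linked (pathEdges p) u v) {i : I} (hu : u ∈ (p i).1.support) : v ∈ (p i).1.support := by
  refine Linked.induct (Q := fun v => v ∈ (p i).1.support) ?_ h hu
  intro a b hab ha
  simp only [pathEdges, Finset.mem_biUnion, Finset.mem_univ, true_and, List.mem_toFinset] at hab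
  obtain ⟨j, hj⟩ := hab
  by_cases hij : i = j
  · exact hij ▸ (p j).1.snd_mem_support_of_mem_edges hj
  · exact absurd ((p j).1.fst_mem_support_of_mem_edges hj) (hp i j hij ha)

theorem typesSeparated_pathEdges
    (hp : ∀ i j : I, i ≠ j → List.Disjoint (p i).1.support (p j).1.support) :
    TypesSeparated (parallelSeq s t) (pathEdges p) (nodes I I') := by
  intro a ha b hb hlink htype
  have hsame : ∀ {i j : I} {v : V}, v ∈ (p i).1.support → v ∈ (p j).1.support → i = j :=
    fun {i j v} hi hj => by_contra fun hij => hp i j hij hi hj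
  rcases mem_nodes_iff.mp ha with ⟨i, hi, rfl⟩ | ⟨i, hi, rfl⟩ <;>
    rcases mem_nodes_iff.mp hb with ⟨j, hj, rfl⟩ | ⟨j, hj, rfl⟩
  · rw [parallelSeq_sourceNode, parallelSeq_sourceNode] at hlink
    have h1 := mem_support_of_linked_pathEdges hp hlink (i := ⟨i, hi⟩) (p ⟨i, hi⟩).1.start_mem_support
    have h2 : (⟨i, hi⟩ : I) = ⟨j, hj⟩ := hsame h1 (p ⟨j, hj⟩).1.start_mem_support
    rw [Subtype.mk.inj h2]
  · rw [nodeType_sourceNode, nodeType_targetNode] at htype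
    exact absurd htype I_ne_neg_I
  · rw [nodeType_sourceNode, nodeType_targetNode] at htype
    exact absurd htype.symm I_ne_neg_I
  · rw [parallelSeq_targetNode, parallelSeq_targetNode] at hlink
    have hend : ∀ (j : Fin n) (hj : j ∈ I'), t j ∈ (p (e.symm ⟨j, hj⟩)).1.support := by
      intro j hj
      have h : t j = t (e (e.symm ⟨j, hj⟩)) := by rw [e.apply_symm_apply]
      rw [h]
      exact (p (e.symm ⟨j, hj⟩)).1.end_mem_support
    have h1 := mem_support_of_linked_pathEdges hp hlink (hend i hi)
    have h2 := e.symm.injective (hsame h1 (hend j hj))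
    rw [Subtype.mk.inj h2]

theorem spinProd_mul_prod_pathEdges
    (hp : ∀ i j : I, i ≠ j → List.Disjoint (p i).1.support (p j).1.support) (σ : Spins V) :
    spinProd (parallelSeq s t) (nodes I I') σ * ∏ a ∈ pathEdges p, edgeSpin σ a = 1 := by
  have h1 : ∏ a ∈ pathEdges p, edgeSpin σ a = ∏ i : I, spin σ (s i) * spin σ (t (e i)) := by
    rw [pathEdges, Finset.prod_biUnion]
    · refine Finset.prod_congr rfl fun i _ => ?_
      rw [List.prod_toFinset _ (p i).2.isTrail.edges_nodup, prod_edgeSpin_edges]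
    · intro i _ j _ hij
      rw [Function.onFun, Finset.disjoint_left]
      intro a ha ha'
      rw [List.mem_toFinset] at ha ha'
      induction a with
      | h u v =>
        exact hp i j hij ((p i).1.fst_mem_support_of_mem_edges ha)
          ((p j).1.fst_mem_support_of_mem_edges ha')
  have h2 : spinProd (parallelSeq s t) (nodes I I') σ
      = ∏ i : I, spin σ (s i) * spin σ (t (e i)) := by
    rw [nodes, spinProd_union, spinProd, spinProd,
      Finset.prod_image fun i _ j _ h => sourceNode_strictMono.injective h,
      Finset.prod_image fun i _ j _ h => targetNode_strictAnti.injective h,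
      Finset.prod_mul_distrib, e.prod_comp fun j : I' => spin σ (t j), Finset.prod_coe_sort I
      fun i => spin σ (s i), Finset.prod_coe_sort I' fun j => spin σ (t j)]
    · simp only [parallelSeq_sourceNode, parallelSeq_targetNode]
    · simp only [Finset.disjoint_left, Finset.mem_image]
      rintro _ ⟨i, -, rfl⟩ ⟨j, -, h⟩
      exact (sourceNode_lt_targetNode i j).ne' h
  rw [h1, ← h2, spinProd_mul_self]

theorem minor_pos_iff_hasDisjointPaths [Fintype V] {G : SimpleGraph V} [DecidableRel G.Adj]
    {J : Sym2 V → ℝ} (hJ : ∀ e ∈ G.edgeSet, 0 ≤ J e) {D : PlaneEmbedding G} {s t : Fin n → V}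
    (hst : D.IsOuterOrder (parallelSeq s t)) {k : ℕ} (I I' : Finset (Fin n)) (hI : I.card = k)
    (hI' : I'.card = k) :
    0 < minor (twoPointMatrix G J 0 s t) I I' hI hI' ↔
      HasDisjointPaths (positiveSubgraph G J) s t I I' := by
  rw [minor_pos_iff hJ hst]
  constructor
  · rintro ⟨H, hH, hs, hsep⟩
    have hHG : ∀ e ∈ H, e ∈ G.edgeSet := fun e he => SimpleGraph.mem_edgeFinset.mp (hH he)
    refine hasDisjointPaths_of_typesSeparated (H := H) ?_ (hI.trans hI'.symm)
      (evenOn_of_sourceWeight_ne_zero hs) hsep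
    intro e he
    have hpos := pos_of_sourceWeight_ne_zero (fun e he => hJ e (hHG e he)) hs he
    have heG := hHG e he
    induction e with
    | h u v => exact positiveSubgraph_adj.mpr ⟨heG, hpos⟩
  · rintro ⟨e, p, hp⟩
    have hmem : ∀ a ∈ pathEdges p, a ∈ G.edgeSet ∧ 0 < J a := by
      intro a ha
      simp only [pathEdges, Finset.mem_biUnion, Finset.mem_univ, true_and, List.mem_toFinset] at ha
      obtain ⟨i, hi⟩ := ha
      have := (p i).1.edges_subset_edgeSet hi
      induction a with
      | h u v => exact positiveSubgraph_adj.mp this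
    exact ⟨pathEdges p, fun a ha => SimpleGraph.mem_edgeFinset.mpr (hmem a ha).1,
      (sourceWeight_pos (fun a ha => (hmem a ha).2) (spinProd_mul_prod_pathEdges hp)).ne',
      typesSeparated_pathEdges hp⟩

end Paths

end BoundaryIsing

end

theorem mainTheorem9 {V : Type*} [Fintype V] [DecidableEq V]
    (G : SimpleGraph V) [DecidableRel G.Adj] (hG : G.Connected)
    (D : BoundaryIsing.PlaneEmbedding G)
    (J : Sym2 V → ℝ) (hJ : ∀ e ∈ G.edgeSet, 0 ≤ J e)
    (n : ℕ) (s t : Fin n → V) (hst : D.IsOuterOrder (BoundaryIsing.parallelSeq s t)) :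
    BoundaryIsing.TotallyNonnegative (BoundaryIsing.twoPointMatrix G J 0 s t) ∧
    (∀ (k : ℕ) (I I' : Finset (Fin n)) (hI : I.card = k) (hI' : I'.card = k),
      0 < BoundaryIsing.minor (BoundaryIsing.twoPointMatrix G J 0 s t) I I' hI hI' ↔
        BoundaryIsing.HasDisjointPaths (BoundaryIsing.positiveSubgraph G J) s t I I') ∧
    ((∀ e ∈ G.edgeSet, 0 < J e) →
      ∀ (k : ℕ) (I I' : Finset (Fin n)) (hI : I.card = k) (hI' : I'.card = k),
        0 < BoundaryIsing.minor (BoundaryIsing.twoPointMatrix G J 0 s t) I I' hI hI' ↔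
          BoundaryIsing.HasDisjointPaths G s t I I') := by
  refine ⟨fun k I I' hI hI' => BoundaryIsing.minor_nonneg hJ hst I I' hI hI',
    fun k I I' hI hI' => BoundaryIsing.minor_pos_iff_hasDisjointPaths hJ hst I I' hI hI',
    fun hpos k I I' hI hI' => ?_⟩
  rw [BoundaryIsing.minor_pos_iff_hasDisjointPaths hJ hst I I' hI hI',
    BoundaryIsing.positiveSubgraph_eq hpos]
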